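/- Let $X=\{x_0,x_1\}$ and let $(\mathbb{C}\langle\langle X\rangle\rangle,\mathbin{\sqcup\!\sqcup},1_{X^*})$ be the commutative $\mathbb{C}$-algebra of noncommutative formal power series over $X$ with the shuffle product $\mathbin{\sqcup\!\sqcup}$. For a series $S$ without constant term put $S^*=\sum_{k\ge 0}S^k$ (powers for concatenation). Let $A=(\mathbb{C}\langle X\rangle,\mathbin{\sqcup\!\sqcup},1_{X^*})[x_0^*,x_1^*,(-x_0)^*]$ be the subalgebra of $(\mathbb{C}\langle\langle X\rangle\rangle,\mathbin{\sqcup\!\sqcup},1_{X^*})$ generated by the noncommutative polynomials $\mathbb{C}\langle X\rangle$ and by $x_0^*$, $x_1^*$, $(-x_0)^*$. Let $\Omega=\mathbb{C}\setminus(]-\infty,0]\cup[1,+\infty[)$, let $\mathcal{H}(\Omega)$ be the algebra of holomorphic functions on $\Omega$, and let $\mathcal{C}=\mathbb{C}[z,z^{-1},(1-z)^{-1}]$, regarded as functions on $\Omega$. For $w\in X^*$ let $\operatorname{Li}_w$ be the polylogarithm on $\Omega$: $\operatorname{Li}_{1_{X^*}}=1$, $\operatorname{Li}_{x_0^n}(z)=\log^n(z)/n!$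 (principal logarithm), $\operatorname{Li}_{x_1w}(z)=\int_0^z\operatorname{Li}_w(s)\,\frac{ds}{1-s}$, and $\operatorname{Li}_{x_0w}(z)=\int_0^z\operatorname{Li}_w(s)\,\frac{ds}{s}$ if $x_1$ occurs in $w$ (integrals along the segment from $0$ to $z$). Let $\mathcal{C}\{\operatorname{Li}_w\}_{w\in X^*}$ be the $\mathcal{C}$-module spanned by the functions $\operatorname{Li}_w$. There is exactly one morphism of $\mathbb{C}$-algebras $\operatorname{Li}^{(1)}_\bullet:A\to\mathcal{H}(\Omega)$ such that $\operatorname{Li}^{(1)}_w=\operatorname{Li}_w$ for all $w\in X^*$, $\operatorname{Li}^{(1)}_{x_0^*}(z)=z$, $\operatorname{Li}^{(1)}_{(-x_0)^*}(z)=1/z$ and $\operatorname{Li}^{(1)}_{x_1^*}(z)=1/(1-z)$. It satisfies: (i) $\operatorname{Im}(\operatorname{Li}^{(1)}_\bullet)=\mathcal{C}\{\operatorname{Li}_w\}_{w\in X^*}$; (ii) $\ker(\operatorname{Li}^{(1)}_\bullet)$ is the ideal of $A$ generated by $x_0^*\mathbin{\sqcup\!\sqcup}x_1^*-x_1^*+1_{X^*}$.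 -/

import Mathlib

open scoped Nat

namespace PolylogShuffle

/-- Formal power series `R⟨⟨α⟩⟩` in the noncommuting letters `α`, i.e. functions from words
(lists of letters) to coefficients. Its `*` below is the *shuffle* product. -/
def NCSeries (α R : Type*) : Type _ := List α → R

namespace NCSeries

variable {α R : Type*}

@[ext] theorem ext {S T : NCSeries α R} (h : ∀ w, S w = T w) : S = T := funext h

noncomputable instance [CommRing R] : AddCommGroup (NCSeries α R) :=
  inferInstanceAs (AddCommGroup (List α → R))

noncomputable instance [CommRing R] : Module R (NCSeries α R) :=
  inferInstanceAs (Module R (List α → R))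

/-- All the ways (one for each set of positions) to split a word into a subword and the
complementary subword: the terms `u ⊗ v` of the coproduct `Δ_⧢(w)`, with multiplicity. -/
def splits : List α → List (List α × List α)
  | [] => [([], [])]
  | a :: w => (splits w).map (fun p => (a :: p.1, p.2)) ++
      (splits w).map (fun p => (p.1, a :: p.2))

variable [CommRing R]

/-- The shuffle product `S ⧢ T`. The coefficient of `w` is the sum of `⟨S|u⟩⟨T|v⟩` over all
splittings of `w` into complementary subwords `u`, `v`. -/
def shuffle (S T : NCSeries α R) : NCSeries α R :=
  fun w => ((splits w).map (fun p => S p.1 * T p.2)).sum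

/-- The series consisting of the single word `w`. -/
def word [DecidableEq α] (w : List α) : NCSeries α R := fun v => if v = w then 1 else 0

/-- The unit series `1_{X^*}` (the empty word). -/
def unit : NCSeries α R
  | [] => 1
  | _ :: _ => 0

noncomputable instance : Mul (NCSeries α R) := ⟨shuffle⟩

noncomputable instance : One (NCSeries α R) := ⟨unit⟩

/-- The left residual of a series by a letter. -/
def resid (a : α) (S : NCSeries α R) : NCSeries α R := fun w => S (a :: w)

theorem add_coeff (S T : NCSeries α R) (w : List α) : (S + T) w = S w + T w := rfl

theorem zero_coeff (w : List α) : (0 : NCSeries α R) w = 0 := rfl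

theorem smul_coeff (c : R) (S : NCSeries α R) (w : List α) : (c • S) w = c * S w := rfl

theorem resid_add (a : α) (S T : NCSeries α R) : resid a (S + T) = resid a S + resid a T := rfl

theorem resid_smul (a : α) (c : R) (S : NCSeries α R) : resid a (c • S) = c • resid a S := rfl

theorem resid_zero (a : α) : resid a (0 : NCSeries α R) = 0 := rfl

theorem resid_one (a : α) : resid a (1 : NCSeries α R) = 0 := rfl

theorem mul_nil (S T : NCSeries α R) : (S * T) [] = S [] * T [] := by
  change shuffle S T [] = _
  simp [shuffle, splits]

theorem mul_cons (S T : NCSeries α R) (a : α) (w : List α) :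
    (S * T) (a :: w) = (resid a S * T) w + (S * resid a T) w := by
  change shuffle S T (a :: w) = shuffle (resid a S) T w + shuffle S (resid a T) w
  simp [shuffle, splits, resid, Function.comp_def]

theorem resid_mul (a : α) (S T : NCSeries α R) :
    resid a (S * T) = resid a S * T + S * resid a T := by
  ext w
  exact mul_cons S T a w

theorem mul_comm' (S T : NCSeries α R) : S * T = T * S := by
  ext w
  induction w generalizing S T with
  | nil => rw [mul_nil, mul_nil, mul_comm]
  | cons a w ih => rw [mul_cons, mul_cons, ih, ih S, add_comm]

theorem add_mul' (S T U : NCSeries α R) : (S + T) * U = S * U + T * U := by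
  ext w
  induction w generalizing S T U with
  | nil => simp only [mul_nil, add_coeff, add_mul]
  | cons a w ih =>
    simp only [mul_cons, add_coeff, resid_add] at ih ⊢
    rw [ih, ih]
    ring

theorem zero_mul' (S : NCSeries α R) : 0 * S = 0 := by
  ext w
  induction w generalizing S with
  | nil => simp only [mul_nil, zero_coeff, zero_mul]
  | cons a w ih =>
    simp only [mul_cons, zero_coeff, resid_zero] at ih ⊢
    rw [ih, ih, add_zero]

theorem one_mul' (S : NCSeries α R) : 1 * S = S := by
  ext w
  induction w generalizing S with
  | nil =>
    rw [mul_nil]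
    exact one_mul _
  | cons a w ih =>
    rw [mul_cons, ih, resid_one, zero_mul', zero_coeff, zero_add]
    rfl

theorem smul_mul' (c : R) (S T : NCSeries α R) : (c • S) * T = c • (S * T) := by
  ext w
  induction w generalizing S T with
  | nil => simp only [mul_nil, smul_coeff, mul_assoc]
  | cons a w ih =>
    simp only [mul_cons, smul_coeff, resid_smul] at ih ⊢
    rw [ih, ih, mul_add]

theorem mul_assoc' (S T U : NCSeries α R) : S * T * U = S * (T * U) := by
  ext w
  induction w generalizing S T U with
  | nil => simp only [mul_nil, mul_assoc]
  | cons a w ih =>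
    have mul_add' (S T U : NCSeries α R) : S * (T + U) = S * T + S * U := by
      rw [mul_comm', add_mul', mul_comm' T, mul_comm' U]
    simp only [mul_cons, resid_mul, add_mul', mul_add', add_coeff]
    rw [ih, ih, ih, add_assoc]

/-- The commutative ring `(R⟨⟨α⟩⟩, ⧢, 1)`. -/
noncomputable instance : CommRing (NCSeries α R) where
  __ := (inferInstance : AddCommGroup (NCSeries α R))
  mul := (· * ·)
  one := 1
  mul_assoc := mul_assoc'
  one_mul := one_mul'
  mul_one S := by rw [mul_comm', one_mul']
  left_distrib S T U := by rw [mul_comm', add_mul', mul_comm' T, mul_comm' U]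
  right_distrib := add_mul'
  zero_mul := zero_mul'
  mul_zero S := by rw [mul_comm', zero_mul']
  mul_comm := mul_comm'

noncomputable instance : Algebra R (NCSeries α R) :=
  Algebra.ofModule smul_mul' fun c S T => by rw [mul_comm', smul_mul', mul_comm']

/-- The concatenation (Cauchy) product. -/
def conc (S T : NCSeries α R) : NCSeries α R :=
  fun w => ∑ i ∈ Finset.range (w.length + 1), S (w.take i) * T (w.drop i)

/-- Powers for the concatenation product. -/
def concPow (S : NCSeries α R) : ℕ → NCSeries α R
  | 0 => unit
  | k + 1 => conc S (concPow S k)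

/-- The star `S^* = ∑_k S^k` (concatenation powers) of a series `S` without constant term; for
such an `S`, the powers `S^k` with `k > |w|` do not contribute to the coefficient of `w`. -/
def kstar (S : NCSeries α R) : NCSeries α R :=
  fun w => ∑ k ∈ Finset.range (w.length + 1), concPow S k w

end NCSeries

open NCSeries

/-- `ℂ⟨⟨X⟩⟩` with the shuffle product, `X = {x₀, x₁}`; the letter `xᵢ` is `i : Fin 2`. -/
abbrev Series : Type := NCSeries (Fin 2) ℂ

/-- The letter `xᵢ` as a series. -/
noncomputable def letter (i : Fin 2) : Series := word [i]

/-- The noncommutative polynomials `ℂ⟨X⟩`: the series with finite support. -/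
def polynomials : Set Series := {S | {w | S w ≠ 0}.Finite}

/-- `(ℂ⟨X⟩, ⧢, 1)[x₀^*, x₁^*, (-x₀)^*]`: the subalgebra of `(ℂ⟨⟨X⟩⟩, ⧢, 1)` generated by `ℂ⟨X⟩`
and the three stars. -/
noncomputable def starAlgebra : Subalgebra ℂ Series :=
  Algebra.adjoin ℂ (polynomials ∪ {kstar (letter 0), kstar (letter 1), kstar (-letter 0)})

/-- A word as an element of `starAlgebra`. -/
noncomputable def wordElt (w : List (Fin 2)) : starAlgebra :=
  ⟨word w, Algebra.subset_adjoin <| Or.inl <|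
    (Set.finite_singleton w).subset fun v hv => by
      by_contra h
      exact hv (if_neg h)⟩

/-- `x₀^*` as an element of `starAlgebra`. -/
noncomputable def x0Star : starAlgebra :=
  ⟨kstar (letter 0), Algebra.subset_adjoin <| by simp⟩

/-- `x₁^*` as an element of `starAlgebra`. -/
noncomputable def x1Star : starAlgebra :=
  ⟨kstar (letter 1), Algebra.subset_adjoin <| by simp⟩

/-- `(-x₀)^*` as an element of `starAlgebra`. -/
noncomputable def negX0Star : starAlgebra :=
  ⟨kstar (-letter 0), Algebra.subset_adjoin <| by simp⟩

/-- The cleft plane `Ω = ℂ ∖ (]-∞, 0] ∪ [1, +∞[)`. -/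
def cleftPlane : Set ℂ := ((fun x : ℝ => (x : ℂ)) '' (Set.Iic 0 ∪ Set.Ici 1))ᶜ

/-- The algebra `ℋ(Ω)` of holomorphic functions on `Ω`, with the pointwise operations. -/
def holo : Subalgebra ℂ (cleftPlane → ℂ) where
  carrier := {f | ∃ g : ℂ → ℂ, DifferentiableOn ℂ g cleftPlane ∧ ∀ z : cleftPlane, f z = g z}
  mul_mem' := by
    rintro _ _ ⟨g, hg, h⟩ ⟨g', hg', h'⟩
    exact ⟨g * g', hg.mul hg', fun z => by simp [h, h']⟩
  add_mem' := by
    rintro _ _ ⟨g, hg, h⟩ ⟨g', hg', h'⟩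
    exact ⟨g + g', hg.add hg', fun z => by simp [h, h']⟩
  algebraMap_mem' c := ⟨fun _ => c, differentiableOn_const c, fun _ => rfl⟩

/-- `∫_0^z f(s) ds` along the straight segment (which stays in `Ω`, but for its end `0`, when
`z ∈ Ω`). -/
noncomputable def segmentIntegral (f : ℂ → ℂ) (z : ℂ) : ℂ := ∫ t in (0 : ℝ)..1, f (t * z) * z

/-- The polylogarithm `Li_w` on `Ω`, as an iterated integral with respect to `ds/s` (letter `x₀`)
and `ds/(1-s)` (letter `x₁`): `Li_1 = 1`, `Li_{x₁w}(z) = ∫_0^z Li_w(s) ds/(1-s)`,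
`Li_{x₀w}(z) = ∫_0^z Li_w(s) ds/s` if `x₁` occurs in `w`, and `Li_{x₀^n}(z) = log^n(z)/n!`. -/
noncomputable def Li : List (Fin 2) → ℂ → ℂ
  | [] => fun _ => 1
  | a :: w =>
    if a = 1 then segmentIntegral fun s => Li w s / (1 - s)
    else if 1 ∈ w then segmentIntegral fun s => Li w s / s
    else fun z => Complex.log z ^ (w.length + 1) / ((w.length + 1)! : ℂ)

/-- The ring `𝒞 = ℂ[z, z⁻¹, (1-z)⁻¹]` of functions on `Ω`. -/
noncomputable def ratAlgebra : Subalgebra ℂ (cleftPlane → ℂ) :=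
  Algebra.adjoin ℂ {fun z : cleftPlane => (z : ℂ), fun z : cleftPlane => (z : ℂ)⁻¹,
    fun z : cleftPlane => (1 - (z : ℂ))⁻¹}

/-- `𝒞{Li_w}_{w ∈ X^*}`: the `𝒞`-module spanned by the polylogarithms. -/
noncomputable def polylogModule : Submodule ratAlgebra (cleftPlane → ℂ) :=
  Submodule.span ratAlgebra (Set.range fun (w : List (Fin 2)) (z : cleftPlane) => Li w z)

/-- The conditions which define the morphism `Li^{(1)}`. -/
structure IsLiOne (μ : starAlgebra →ₐ[ℂ] holo) : Prop where
  map_word : ∀ (w : List (Fin 2)) (z : cleftPlane), (μ (wordElt w)).1 z = Li w z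
  map_x0Star : ∀ z : cleftPlane, (μ x0Star).1 z = z
  map_negX0Star : ∀ z : cleftPlane, (μ negX0Star).1 z = 1 / z
  map_x1Star : ∀ z : cleftPlane, (μ x1Star).1 z = 1 / (1 - z)

end PolylogShuffle

/-! The shuffle algebra has two commuting derivations, the left residuals by `x₀` and `x₁`. A star
`(a₀x₀ + a₁x₁)^*` is a shuffle exponential: an eigenvector of both residuals, with exponents adding
under the product.

Existence. On polynomials, `S ↦ Li_S` is a morphism (`polyLi_word_mul_word`, `polyLi_mul`): both
sides of the shuffle relation satisfy the same differential equation, and their difference tends to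
0 at the origin. Moreover `A` is free over `ℂ⟨X⟩` on the products `(k x₀)^* ⧢ (l x₁)^*`, `k ∈ ℤ`, `l
∈ ℕ` (`starEquiv`), because these lie in distinct generalized eigenspaces of one derivation. So `A`
is a monoid algebra over `ℂ⟨X⟩`, and sending these products to `z^k (1-z)^{-l}` extends the
morphism. Uniqueness is clear on generators, and the image is read off from the free description.

Kernel. Modulo the ideal, `x₁^*` is inverse to `1 - x₀^*`, and `(-x₀)^*` is inverse to `x₀^*`. Hence
a power of the unit `x₀^* ⧢ (1 - x₀^*)` carries any element of `A` to a polynomial in `x₀^*` over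
`ℂ⟨X⟩` (`exists_pow_mul_sub_evalX0Star_mem`). On such polynomials the morphism is injective, because
the `Li_w` are linearly independent over `ℂ[z]` (`eq_zero_of_polyLi_specialize_eq_zero`). This
independence rests on the fact that no nonzero combination of `1/z` and `1/(1-z)` has a rational
primitive. -/

namespace PolylogShuffle

open NCSeries Filter Topology Set

/-! ### Geometry of the cleft plane -/

theorem mem_cleftPlane_iff {z : ℂ} :
    z ∈ cleftPlane ↔ z.im ≠ 0 ∨ (0 < z.re ∧ z.re < 1) := by
  simp only [cleftPlane, mem_compl_iff, mem_image, mem_union, mem_Iic, mem_Ici, not_exists,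
    not_and]
  constructor
  · intro h
    by_contra! h'
    have h1 : ((z.re : ℝ) : ℂ) = z := Complex.ext (by simp) (by simp [h'.1])
    refine h z.re ?_ h1
    by_contra! h2
    linarith [h'.2 h2.1]
  · rintro h x hx rfl
    simp only [Complex.ofReal_im, ne_eq, not_true_eq_false, Complex.ofReal_re, false_or] at h
    rcases hx with hx | hx <;> linarith [h.1, h.2]

theorem isOpen_cleftPlane : IsOpen cleftPlane :=
  (Complex.isometry_ofReal.isClosedEmbedding.isClosedMap _
    (isClosed_Iic.union isClosed_Ici)).isOpen_compl

theorem ofReal_mul_mem_cleftPlane {z : ℂ} (hz : z ∈ cleftPlane) {t : ℝ} (h0 : 0 < t)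
    (h1 : t ≤ 1) : (t : ℂ) * z ∈ cleftPlane := by
  rw [mem_cleftPlane_iff] at hz ⊢
  simp only [Complex.im_ofReal_mul, Complex.re_ofReal_mul]
  rcases hz with hz | ⟨hz0, hz1⟩
  · exact Or.inl (mul_ne_zero h0.ne' hz)
  · exact Or.inr ⟨mul_pos h0 hz0, by nlinarith⟩

theorem ne_zero_of_mem_cleftPlane {z : ℂ} (hz : z ∈ cleftPlane) : z ≠ 0 := by
  rintro rfl
  simp [mem_cleftPlane_iff] at hz

theorem one_sub_ne_zero_of_mem_cleftPlane {z : ℂ} (hz : z ∈ cleftPlane) : 1 - z ≠ 0 := by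
  intro h
  obtain rfl : z = 1 := (sub_eq_zero.1 h).symm
  simp [mem_cleftPlane_iff] at hz

theorem cleftPlane_subset_slitPlane : cleftPlane ⊆ Complex.slitPlane := by
  intro z hz
  rw [mem_cleftPlane_iff] at hz
  rw [Complex.mem_slitPlane_iff]
  tauto

theorem half_mem_cleftPlane : (1 / 2 : ℂ) ∈ cleftPlane := by
  rw [mem_cleftPlane_iff]
  norm_num

theorem isPreconnected_cleftPlane : IsPreconnected cleftPlane := by
  have h : StarConvex ℝ (1 / 2 : ℂ) cleftPlane := by
    rw [starConvex_iff_forall_pos half_mem_cleftPlane]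
    intro z hz a b ha hb hab
    rw [mem_cleftPlane_iff] at hz ⊢
    simp only [Complex.add_im, Complex.add_re, Complex.real_smul, Complex.im_ofReal_mul,
      Complex.re_ofReal_mul]
    norm_num
    rcases hz with hz | ⟨hz0, hz1⟩
    · exact Or.inl ⟨hb.ne', hz⟩
    · exact Or.inr ⟨by positivity, by nlinarith⟩
  exact (h.isPathConnected half_mem_cleftPlane).isConnected.isPreconnected

/-! ### Growth along rays to the origin, and primitives along segments -/

/-- `f(tz) = O(t^α)` as `t → 0⁺`, locally uniformly in `z ∈ Ω`. -/
def RayGrowth (α : ℝ) (f : ℂ → ℂ) : Prop :=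
  ∀ K ⊆ cleftPlane, IsCompact K →
    ∃ M, ∀ t : ℝ, 0 < t → t ≤ 1 → ∀ z ∈ K, ‖f (t * z)‖ ≤ M * t ^ α

theorem RayGrowth.mono {α β : ℝ} {f : ℂ → ℂ} (hf : RayGrowth α f) (h : β ≤ α) :
    RayGrowth β f := by
  intro K hK hK'
  obtain ⟨M, hM⟩ := hf K hK hK'
  refine ⟨|M|, fun t h0 h1 z hz => (hM t h0 h1 z hz).trans ?_⟩
  calc M * t ^ α ≤ |M| * t ^ α := by gcongr; exact le_abs_self M
    _ ≤ |M| * t ^ β :=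
      mul_le_mul_of_nonneg_left (Real.rpow_le_rpow_of_exponent_ge h0 h1 h) (abs_nonneg M)

theorem RayGrowth.div_id {α : ℝ} {f : ℂ → ℂ} (hf : RayGrowth α f) :
    RayGrowth (α - 1) fun s => f s / s := by
  intro K hK hK'
  obtain ⟨M, hM⟩ := hf K hK hK'
  obtain ⟨B, hB⟩ := hK'.exists_bound_of_continuousOn (f := fun z : ℂ => z⁻¹)
    (continuousOn_id.inv₀ fun z hz => ne_zero_of_mem_cleftPlane (hK hz))
  refine ⟨M * B, fun t h0 h1 z hz => ?_⟩
  have h2 := hM t h0 h1 z hz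
  have h3 := hB z hz
  rw [Real.rpow_sub h0, Real.rpow_one]
  calc ‖f (t * z) / (t * z)‖ = ‖f (t * z)‖ * ‖z⁻¹‖ / t := by
        rw [norm_div, norm_mul, norm_inv, Complex.norm_real, Real.norm_of_nonneg h0.le]
        ring
    _ ≤ (M * t ^ α) * B / t := by
        gcongr
        exact (norm_nonneg _).trans h2
    _ = M * B * (t ^ α / t) := by ring

theorem RayGrowth.div_one_sub {α : ℝ} {f : ℂ → ℂ} (hf : RayGrowth α f) :
    RayGrowth α fun s => f s / (1 - s) := by
  intro K hK hK'
  obtain ⟨M, hM⟩ := hf K hK hK'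
  -- Including `t = 0`, where the denominator is 1, makes the parameter set compact although `0 ∉
  -- Ω`.
  have hcont : ContinuousOn (fun p : ℝ × ℂ => (1 - (p.1 : ℂ) * p.2)⁻¹) (Icc 0 1 ×ˢ K) := by
    refine ContinuousOn.inv₀ (by fun_prop) ?_
    rintro ⟨t, z⟩ ⟨⟨h0, h1⟩, hz⟩
    rcases h0.eq_or_lt with rfl | h0
    · simp
    · exact one_sub_ne_zero_of_mem_cleftPlane (ofReal_mul_mem_cleftPlane (hK hz) h0 h1)
  obtain ⟨B, hB⟩ := (isCompact_Icc.prod hK').exists_bound_of_continuousOn hcont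
  refine ⟨M * B, fun t h0 h1 z hz => ?_⟩
  have h2 := hM t h0 h1 z hz
  have h3 := hB (t, z) ⟨⟨h0.le, h1⟩, hz⟩
  calc ‖f (t * z) / (1 - t * z)‖ = ‖f (t * z)‖ * ‖(1 - (t : ℂ) * z)⁻¹‖ := by
        rw [div_eq_mul_inv, norm_mul]
    _ ≤ (M * t ^ α) * B := by
        gcongr
        exact (norm_nonneg _).trans h2
    _ = M * B * t ^ α := by ring

/-- At `tz` the integrand is `f(xtz) · tz`: the first factor gives `x^α t^α`, integrable in `x`
because `α > -1`, and the second gives one more power of `t`. -/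
theorem RayGrowth.segmentIntegral {α : ℝ} (hα : -1 < α) {f : ℂ → ℂ} (hf : RayGrowth α f) :
    RayGrowth (α + 1) (segmentIntegral f) := by
  intro K hK hK'
  obtain ⟨M, hM⟩ := hf K hK hK'
  obtain ⟨B, hB⟩ := hK'.exists_bound_of_continuousOn (f := fun z : ℂ => z) continuousOn_id
  refine ⟨∫ x in (0 : ℝ)..1, M * B * x ^ α, fun t h0 h1 z hz => ?_⟩
  have h := intervalIntegral.norm_integral_le_of_norm_le (a := 0) (b := 1)
    (f := fun x : ℝ => f (x * (t * z)) * (t * z)) (g := fun x => M * B * x ^ α * t ^ (α + 1))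
    (μ := MeasureTheory.volume) zero_le_one (Eventually.of_forall ?_) ?_
  · rw [intervalIntegral.integral_mul_const (t ^ (α + 1))] at h
    exact h
  · rintro x ⟨hx0, hx1⟩
    have h2 := hM (x * t) (by positivity) (mul_le_one₀ hx1 h0.le h1) z hz
    have h3 := hB z hz
    rw [Complex.ofReal_mul, mul_assoc, Real.mul_rpow hx0.le h0.le] at h2
    rw [norm_mul, norm_mul, Complex.norm_real, Real.norm_of_nonneg h0.le, Real.rpow_add h0,
      Real.rpow_one]
    calc ‖f (x * (t * z))‖ * (t * ‖z‖) ≤ (M * (x ^ α * t ^ α)) * (t * B) := by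
          gcongr
          exact (norm_nonneg _).trans h2
      _ = M * B * x ^ α * (t ^ α * t) := by ring
  · exact ((intervalIntegral.intervalIntegrable_rpow' hα).const_mul _).mul_const _

/-- Differentiating `∫ f(tz) z dt` under the integral sign gives the integrand `f'(tz) t z + f(tz)`,
which is the `t`-derivative of `t f(tz)`. The fundamental theorem of calculus then leaves `f(z)`. -/
theorem RayGrowth.hasDerivAt_segmentIntegral {α : ℝ} (hα : -1 < α) {f : ℂ → ℂ}
    (hf : RayGrowth α f) (hd : DifferentiableOn ℂ f cleftPlane) {z : ℂ} (hz : z ∈ cleftPlane) :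
    HasDerivAt (PolylogShuffle.segmentIntegral f) (f z) z := by
  obtain ⟨ε, hε, hball⟩ := Metric.nhds_basis_closedBall.mem_iff.1
    (isOpen_cleftPlane.mem_nhds hz)
  obtain ⟨M, hM⟩ := hf _ hball (isCompact_closedBall z ε)
  have hdiff {w : ℂ} (hw : w ∈ cleftPlane) : DifferentiableAt ℂ f w :=
    hd.differentiableAt (isOpen_cleftPlane.mem_nhds hw)
  have hmem {w : ℂ} (hw : w ∈ Metric.ball z (ε / 2)) : w ∈ cleftPlane :=
    hball (Metric.ball_subset_closedBall (Metric.ball_subset_ball (by linarith) hw))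
  -- the Cauchy estimate on the disc of radius `t * ε / 2` around `t * w`
  have hderiv (t : ℝ) (h0 : 0 < t) (h1 : t ≤ 1) (w : ℂ) (hw : w ∈ Metric.ball z (ε / 2)) :
      ‖deriv f (t * w)‖ ≤ M * t ^ α / (t * (ε / 2)) := by
    have hsub : Metric.closedBall ((t : ℂ) * w) (t * (ε / 2)) ⊆
        (fun v => (t : ℂ) * v) '' Metric.closedBall z ε := by
      intro v hv
      have ht : (t : ℂ) ≠ 0 := by exact_mod_cast h0.ne'
      refine ⟨(t : ℂ)⁻¹ * v, ?_, by field_simp⟩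
      rw [Metric.mem_closedBall] at hv ⊢
      rw [Metric.mem_ball] at hw
      have : dist ((t : ℂ)⁻¹ * v) w ≤ ε / 2 := by
        rw [dist_eq_norm] at hv ⊢
        have h4 : (t : ℂ)⁻¹ * v - w = (t : ℂ)⁻¹ * (v - t * w) := by field_simp
        rw [h4, norm_mul, norm_inv, Complex.norm_real, Real.norm_of_nonneg h0.le]
        rw [inv_mul_le_iff₀ h0]
        exact hv
      linarith [dist_triangle ((t : ℂ)⁻¹ * v) w z]
    refine Complex.norm_deriv_le_of_forall_mem_sphere_norm_le (by positivity) ?_ ?_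
    · refine DifferentiableOn.diffContOnCl_ball (U := cleftPlane) hd ?_
      intro v hv
      obtain ⟨u, hu, rfl⟩ := hsub hv
      exact ofReal_mul_mem_cleftPlane (hball hu) h0 h1
    · intro v hv
      obtain ⟨u, hu, rfl⟩ := hsub (Metric.sphere_subset_closedBall hv)
      exact hM t h0 h1 u hu
  have hmeas {g : ℝ → ℂ} (hg : ContinuousOn g (Ioc 0 1)) : MeasureTheory.AEStronglyMeasurable g
      (MeasureTheory.volume.restrict (uIoc (0 : ℝ) 1)) := by
    rw [uIoc_of_le zero_le_one]
    exact hg.aestronglyMeasurable measurableSet_Ioc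
  have hcont {g : ℂ → ℂ} (hg : ContinuousOn g cleftPlane) {w : ℂ} (hw : w ∈ cleftPlane) :
      ContinuousOn (fun t : ℝ => g (t * w)) (Ioc 0 1) :=
    hg.comp (by fun_prop) fun t ht => ofReal_mul_mem_cleftPlane hw ht.1 ht.2
  have hint : IntervalIntegrable (fun t : ℝ => f (t * z) * z) MeasureTheory.volume 0 1 := by
    refine IntervalIntegrable.mono_fun'
      (g := fun t => M * t ^ α * ‖z‖)
      (((intervalIntegral.intervalIntegrable_rpow' hα).const_mul _).mul_const _)
      (hmeas ((hcont hd.continuousOn hz).mul continuousOn_const)) ?_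
    rw [uIoc_of_le zero_le_one]
    refine (MeasureTheory.ae_restrict_iff' measurableSet_Ioc).2 (Eventually.of_forall fun t ht => ?_)
    refine (norm_mul _ _).trans_le (mul_le_mul_of_nonneg_right ?_ (norm_nonneg z))
    exact hM t ht.1 ht.2 z (Metric.mem_closedBall_self hε.le)
  -- In `bound`, the first summand is the Cauchy estimate times `t` and `‖w‖ ≤ ‖z‖ + ε`; the second
  -- bounds `f(tw)` itself.
  have key := intervalIntegral.hasDerivAt_integral_of_dominated_loc_of_deriv_le
    (μ := MeasureTheory.volume) (a := 0) (b := 1) (x₀ := z) (s := Metric.ball z (ε / 2))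
    (F := fun w t => f (t * w) * w)
    (F' := fun w t => deriv f (t * w) * t * w + f (t * w))
    (bound := fun t => M * (2 / ε) * (‖z‖ + ε) * t ^ α + M * t ^ α)
    (Metric.ball_mem_nhds z (by positivity)) ?_ hint ?_ ?_ ?_ ?_
  · have hftc : ∫ t in (0 : ℝ)..1, (deriv f (t * z) * t * z + f (t * z)) =
        ((1 : ℝ) : ℂ) * f ((1 : ℝ) * z) - ((0 : ℝ) : ℂ) * f ((0 : ℝ) * z) := by
      refine intervalIntegral.integral_eq_sub_of_hasDerivAt_of_le
        (f := fun t : ℝ => (t : ℂ) * f (t * z)) zero_le_one ?_ ?_ key.1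
      · intro t ht
        rcases ht.1.eq_or_lt with rfl | h0
        -- Continuity of `t f(tz)` at the end `t = 0`: it is `O(t^(α+1))` with `α + 1 > 0`, and the
        -- factor `t` makes its value there 0.
        · have hlim : Tendsto (fun t : ℝ => M * t ^ (α + 1)) (𝓝[Icc 0 1] 0) (𝓝 0) := by
            have h5 : ContinuousAt (fun t : ℝ => M * t ^ (α + 1)) 0 :=
              continuousAt_const.mul (Real.continuousAt_rpow_const _ _ (Or.inr (by linarith)))
            have h6 := h5.tendsto
            rw [Real.zero_rpow (by linarith), mul_zero] at h6
            exact h6.mono_left nhdsWithin_le_nhds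
          have h7 : Tendsto (fun t : ℝ => (t : ℂ) * f (t * z)) (𝓝[Icc 0 1] 0) (𝓝 0) := by
            refine squeeze_zero_norm' ?_ hlim
            filter_upwards [self_mem_nhdsWithin] with t ht
            rcases ht.1.eq_or_lt with rfl | h0
            · simp [Real.zero_rpow (show α + 1 ≠ 0 by linarith)]
            · rw [norm_mul, Complex.norm_real, Real.norm_of_nonneg h0.le, Real.rpow_add h0,
                Real.rpow_one]
              calc t * ‖f (t * z)‖ ≤ t * (M * t ^ α) := by
                    gcongr
                    exact hM t h0 ht.2 z (Metric.mem_closedBall_self hε.le)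
                _ = M * (t ^ α * t) := by ring
          simpa [ContinuousWithinAt] using h7
        · refine ContinuousAt.continuousWithinAt ?_
          have h8 := (hdiff (ofReal_mul_mem_cleftPlane hz h0 ht.2)).continuousAt
          exact Complex.continuous_ofReal.continuousAt.mul
            (ContinuousAt.comp (f := fun t : ℝ => (t : ℂ) * z) h8 (by fun_prop))
      · intro t ht
        have h9 := (hdiff (ofReal_mul_mem_cleftPlane hz ht.1 ht.2.le)).hasDerivAt
        have h10 : HasDerivAt (fun s : ℂ => s * z) z (t : ℂ) := by
          simpa using (hasDerivAt_id (t : ℂ)).mul_const z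
        have h11 := (hasDerivAt_id (t : ℂ)).mul (HasDerivAt.comp (t : ℂ) h9 h10)
        refine h11.comp_ofReal.congr_deriv ?_
        simp only [Function.comp_apply, id_eq]
        ring
    have h12 := key.2
    rw [hftc] at h12
    simp only [Complex.ofReal_one, one_mul, Complex.ofReal_zero, zero_mul, sub_zero] at h12
    exact h12
  · filter_upwards [Metric.ball_mem_nhds z (show 0 < ε / 2 by positivity)] with w hw
    exact hmeas ((hcont hd.continuousOn (hmem hw)).mul continuousOn_const)
  · have h13 := (hd.deriv isOpen_cleftPlane).continuousOn
    exact hmeas ((((hcont h13 hz).mul Complex.continuous_ofReal.continuousOn).mul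
      continuousOn_const).add (hcont hd.continuousOn hz))
  · refine Eventually.of_forall fun t ht w hw => ?_
    rw [uIoc_of_le zero_le_one] at ht
    have hw' : w ∈ Metric.closedBall z ε :=
      Metric.ball_subset_closedBall (Metric.ball_subset_ball (by linarith) hw)
    have hwn : ‖w‖ ≤ ‖z‖ + ε := by
      rw [mem_closedBall_iff_norm] at hw'
      linarith [norm_le_insert' w z]
    have h14 := hderiv t ht.1 ht.2 w hw
    refine (norm_add_le _ _).trans (add_le_add ?_ (hM t ht.1 ht.2 w hw'))
    rw [norm_mul, norm_mul, Complex.norm_real, Real.norm_of_nonneg ht.1.le]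
    have h15 : ‖deriv f (t * w)‖ * t ≤ M * (2 / ε) * t ^ α := by
      calc ‖deriv f (t * w)‖ * t ≤ M * t ^ α / (t * (ε / 2)) * t := by
            gcongr
            exact ht.1.le
        _ = M * (2 / ε) * t ^ α := by
            have := ht.1.ne'
            field_simp
    calc ‖deriv f (t * w)‖ * t * ‖w‖ ≤ M * (2 / ε) * t ^ α * (‖z‖ + ε) := by
          gcongr
          exact (mul_nonneg (norm_nonneg _) ht.1.le).trans h15
      _ = M * (2 / ε) * (‖z‖ + ε) * t ^ α := by ring
  · exact ((intervalIntegral.intervalIntegrable_rpow' hα).const_mul _).add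
      ((intervalIntegral.intervalIntegrable_rpow' hα).const_mul _)
  · refine Eventually.of_forall fun t ht w hw => ?_
    rw [uIoc_of_le zero_le_one] at ht
    have h9 := (hdiff (ofReal_mul_mem_cleftPlane (hmem hw) ht.1 ht.2)).hasDerivAt
    have h10 : HasDerivAt (fun s : ℂ => (t : ℂ) * s) t w := by
      simpa using (hasDerivAt_id w).const_mul (t : ℂ)
    have h11 := (HasDerivAt.comp w h9 h10).mul (hasDerivAt_id w)
    exact h11.congr_deriv (by simp)

theorem rayGrowth_log_pow (n : ℕ) {ε : ℝ} (hε : 0 < ε) :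
    RayGrowth (-ε) fun z => Complex.log z ^ n := by
  intro K hK hK'
  obtain ⟨B, hB⟩ := hK'.exists_bound_of_continuousOn (f := Complex.log)
    fun z hz => (continuousAt_clog (cleftPlane_subset_slitPlane (hK hz))).continuousWithinAt
  set δ : ℝ := ε / (n + 1) with hδ
  have hδ0 : 0 < δ := by positivity
  -- `log(tz) = log t + log z` and `|log t| ≤ t^(-δ)/δ`; dividing `ε` by `n + 1` rather than `n`
  -- covers `n = 0` and still gives `δ n ≤ ε`.
  refine ⟨(1 / δ + |B|) ^ n, fun t h0 h1 z hz => ?_⟩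
  have h2 : |Real.log t| ≤ 1 / δ * t ^ (-δ) := by
    have h3 := (Real.abs_log_mul_self_rpow_lt t δ h0 h1 hδ0).le
    rw [abs_mul, abs_of_pos (Real.rpow_pos_of_pos h0 δ)] at h3
    rw [Real.rpow_neg h0.le, ← div_eq_mul_inv, le_div_iff₀ (Real.rpow_pos_of_pos h0 δ)]
    exact h3
  have h4 : (1 : ℝ) ≤ t ^ (-δ) := Real.one_le_rpow_of_pos_of_le_one_of_nonpos h0 h1 (by linarith)
  have h5 : ‖Complex.log (t * z)‖ ≤ (1 / δ + |B|) * t ^ (-δ) := by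
    rw [Complex.log_ofReal_mul h0 (ne_zero_of_mem_cleftPlane (hK hz))]
    refine (norm_add_le _ _).trans ?_
    rw [Complex.norm_real, Real.norm_eq_abs, add_mul]
    refine add_le_add h2 ((hB z hz).trans ((le_abs_self B).trans ?_))
    nlinarith [abs_nonneg B]
  rw [norm_pow]
  calc ‖Complex.log (t * z)‖ ^ n ≤ ((1 / δ + |B|) * t ^ (-δ)) ^ n := by gcongr
    _ = (1 / δ + |B|) ^ n * t ^ (-δ * n) := by
        rw [mul_pow, Real.rpow_mul h0.le, Real.rpow_natCast]
    _ ≤ (1 / δ + |B|) ^ n * t ^ (-ε) := by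
        gcongr ?_ * ?_
        refine Real.rpow_le_rpow_of_exponent_ge h0 h1 ?_
        rw [hδ, neg_mul, neg_le_neg_iff, div_mul_eq_mul_div, div_le_iff₀ (by positivity)]
        nlinarith

theorem RayGrowth.const_mul {α : ℝ} {f : ℂ → ℂ} (hf : RayGrowth α f) (c : ℂ) :
    RayGrowth α fun z => c * f z := by
  intro K hK hK'
  obtain ⟨M, hM⟩ := hf K hK hK'
  refine ⟨‖c‖ * M, fun t h0 h1 z hz => ?_⟩
  rw [norm_mul, mul_assoc]
  exact mul_le_mul_of_nonneg_left (hM t h0 h1 z hz) (norm_nonneg c)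

theorem RayGrowth.mul {α β : ℝ} {f g : ℂ → ℂ} (hf : RayGrowth α f) (hg : RayGrowth β g) :
    RayGrowth (α + β) fun z => f z * g z := by
  intro K hK hK'
  obtain ⟨M, hM⟩ := hf K hK hK'
  obtain ⟨N, hN⟩ := hg K hK hK'
  refine ⟨M * N, fun t h0 h1 z hz => ?_⟩
  rw [norm_mul, Real.rpow_add h0]
  calc ‖f (t * z)‖ * ‖g (t * z)‖ ≤ (M * t ^ α) * (N * t ^ β) := by
        gcongr
        · exact (norm_nonneg _).trans (hM t h0 h1 z hz)
        · exact hM t h0 h1 z hz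
        · exact hN t h0 h1 z hz
    _ = M * N * (t ^ α * t ^ β) := by ring

theorem RayGrowth.tendsto_zero {α : ℝ} (hα : 0 < α) {f : ℂ → ℂ} (hf : RayGrowth α f) {z : ℂ}
    (hz : z ∈ cleftPlane) : Tendsto (fun t : ℝ => f (t * z)) (𝓝[>] 0) (𝓝 0) := by
  obtain ⟨M, hM⟩ := hf {z} (by simpa using hz) isCompact_singleton
  have hlim : Tendsto (fun t : ℝ => M * t ^ α) (𝓝[>] 0) (𝓝 0) := by
    have h5 : ContinuousAt (fun t : ℝ => M * t ^ α) 0 :=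
      continuousAt_const.mul (Real.continuousAt_rpow_const _ _ (Or.inr hα.le))
    have h6 := h5.tendsto
    rw [Real.zero_rpow hα.ne', mul_zero] at h6
    exact h6.mono_left nhdsWithin_le_nhds
  refine squeeze_zero_norm' ?_ hlim
  filter_upwards [Ioc_mem_nhdsGT (zero_lt_one' ℝ)] with t ht
  exact hM t ht.1 ht.2 z rfl

/-! ### Holomorphy, growth and derivatives of the polylogarithms -/

theorem Li_of_one_notMem {w : List (Fin 2)} (hw : 1 ∉ w) :
    Li w = fun z => Complex.log z ^ w.length / (w.length ! : ℂ) := by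
  cases w with
  | nil => ext z; simp [Li]
  | cons a w =>
    simp only [List.mem_cons, not_or] at hw
    rw [Li, if_neg (Ne.symm hw.1), if_neg hw.2]
    rfl

theorem Li_one_cons (w : List (Fin 2)) :
    Li (1 :: w) = segmentIntegral fun s => Li w s / (1 - s) := by
  rw [Li, if_pos rfl]

theorem Li_zero_cons {w : List (Fin 2)} (hw : 1 ∈ w) :
    Li (0 :: w) = segmentIntegral fun s => Li w s / s := by
  rw [Li, if_neg (by decide), if_pos hw]

theorem differentiableOn_div_id {f : ℂ → ℂ} (hf : DifferentiableOn ℂ f cleftPlane) :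
    DifferentiableOn ℂ (fun s => f s / s) cleftPlane :=
  hf.div differentiableOn_id fun _ hz => ne_zero_of_mem_cleftPlane hz

theorem differentiableOn_div_one_sub {f : ℂ → ℂ} (hf : DifferentiableOn ℂ f cleftPlane) :
    DifferentiableOn ℂ (fun s => f s / (1 - s)) cleftPlane :=
  hf.div (by fun_prop) fun _ hz => one_sub_ne_zero_of_mem_cleftPlane hz

/-- The two exponents reproduce each other. Powers of `log` are `O(t^(-1/4))`; integrating an
`O(t^(-1/4))` function gives `O(t^(3/4))`; dividing that by `s` returns to `O(t^(-1/4))`. So once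
`x₁` has occurred, every further integral converges at 0. -/
theorem differentiableOn_Li_and_rayGrowth (w : List (Fin 2)) :
    DifferentiableOn ℂ (Li w) cleftPlane ∧ RayGrowth (-1 / 4) (Li w) ∧
      (1 ∈ w → RayGrowth (3 / 4) (Li w)) := by
  by_cases hw : 1 ∈ w
  · induction w with
    | nil => simp at hw
    | cons a w ih =>
      suffices h : ∃ f, Li (a :: w) = segmentIntegral f ∧ DifferentiableOn ℂ f cleftPlane ∧
          RayGrowth (-1 / 4) f by
        obtain ⟨f, h1, h2, h3⟩ := h
        have h4 := h3.segmentIntegral (by norm_num)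
        rw [h1]
        norm_num at h4
        exact ⟨fun z hz => (h3.hasDerivAt_segmentIntegral (by norm_num) h2
          hz).differentiableAt.differentiableWithinAt, h4.mono (by norm_num), fun _ => h4⟩
      have hlog (h : 1 ∉ w) : DifferentiableOn ℂ (Li w) cleftPlane ∧
          RayGrowth (-1 / 4) (Li w) := by
        rw [Li_of_one_notMem h]
        constructor
        · refine DifferentiableOn.div_const (DifferentiableOn.pow ?_ _) _
          exact fun z hz => (Complex.differentiableAt_log
            (cleftPlane_subset_slitPlane hz)).differentiableWithinAt
        · simp only [div_eq_inv_mul]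
          exact ((rayGrowth_log_pow w.length (by norm_num : (0 : ℝ) < 4⁻¹)).const_mul _).mono
            (by norm_num)
      have hw' : DifferentiableOn ℂ (Li w) cleftPlane ∧ RayGrowth (-1 / 4) (Li w) := by
        by_cases h : 1 ∈ w
        · exact ⟨(ih h).1, (ih h).2.1⟩
        · exact hlog h
      by_cases ha : a = 1
      · subst ha
        exact ⟨_, Li_one_cons w, differentiableOn_div_one_sub hw'.1, hw'.2.div_one_sub⟩
      · obtain rfl : a = 0 := by omega
        have h : 1 ∈ w := by simpa using hw
        refine ⟨_, Li_zero_cons h, differentiableOn_div_id hw'.1, ?_⟩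
        exact ((ih h).2.2 h).div_id.mono (by norm_num)
  · refine ⟨?_, ?_, fun h => absurd h hw⟩
    · rw [Li_of_one_notMem hw]
      refine DifferentiableOn.div_const (DifferentiableOn.pow ?_ _) _
      exact fun z hz => (Complex.differentiableAt_log
        (cleftPlane_subset_slitPlane hz)).differentiableWithinAt
    · rw [Li_of_one_notMem hw]
      simp only [div_eq_inv_mul]
      exact ((rayGrowth_log_pow w.length (by norm_num : (0 : ℝ) < 4⁻¹)).const_mul _).mono
        (by norm_num)

theorem differentiableOn_Li (w : List (Fin 2)) : DifferentiableOn ℂ (Li w) cleftPlane :=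
  (differentiableOn_Li_and_rayGrowth w).1

theorem rayGrowth_Li (w : List (Fin 2)) : RayGrowth (-1 / 4) (Li w) :=
  (differentiableOn_Li_and_rayGrowth w).2.1

theorem rayGrowth_Li_of_one_mem {w : List (Fin 2)} (hw : 1 ∈ w) : RayGrowth (3 / 4) (Li w) :=
  (differentiableOn_Li_and_rayGrowth w).2.2 hw

theorem hasDerivAt_Li_one_cons (w : List (Fin 2)) {z : ℂ} (hz : z ∈ cleftPlane) :
    HasDerivAt (Li (1 :: w)) (Li w z / (1 - z)) z := by
  rw [Li_one_cons]
  exact (rayGrowth_Li w).div_one_sub.hasDerivAt_segmentIntegral (by norm_num)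
    (differentiableOn_div_one_sub (differentiableOn_Li w)) hz

theorem hasDerivAt_Li_zero_cons (w : List (Fin 2)) {z : ℂ} (hz : z ∈ cleftPlane) :
    HasDerivAt (Li (0 :: w)) (Li w z / z) z := by
  by_cases hw : 1 ∈ w
  · rw [Li_zero_cons hw]
    exact (rayGrowth_Li_of_one_mem hw).div_id.hasDerivAt_segmentIntegral (by norm_num)
      (differentiableOn_div_id (differentiableOn_Li w)) hz
  · rw [Li_of_one_notMem (w := 0 :: w) (by simpa using hw), Li_of_one_notMem hw]
    have h := ((Complex.hasDerivAt_log (cleftPlane_subset_slitPlane hz)).pow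
      (w.length + 1)).div_const ((w.length + 1)! : ℂ)
    refine h.congr_deriv ?_
    have h1 := ne_zero_of_mem_cleftPlane hz
    have h2 : (w.length ! : ℂ) ≠ 0 := by exact_mod_cast w.length.factorial_ne_zero
    have h3 : (w.length + 1 : ℂ) ≠ 0 := by exact_mod_cast w.length.succ_ne_zero
    rw [Nat.factorial_succ]
    push_cast
    field_simp

/-! ### Noncommutative polynomials and the shuffle relation for polylogarithms -/

theorem series_ext_resid {S T : Series} (h : S [] = T []) (h' : ∀ a, resid a S = resid a T) :
    S = T := by
  ext w
  cases w with
  | nil => exact h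
  | cons a w => exact congrFun (h' a) w

theorem mem_polynomials_iff {S : Series} :
    S ∈ polynomials ↔ ∃ N : ℕ, ∀ w, N ≤ w.length → S w = 0 := by
  constructor
  · intro h
    obtain ⟨N, hN⟩ := (h.image List.length).bddAbove
    refine ⟨N + 1, fun w hw => ?_⟩
    by_contra hS
    have := hN ⟨w, hS, rfl⟩
    omega
  · rintro ⟨N, hN⟩
    refine (List.finite_length_lt (Fin 2) N).subset fun w hw => ?_
    by_contra h
    exact hw (hN w (not_lt.1 h))

theorem mul_eq_zero_of_length {S T : Series} {m n : ℕ} (hS : ∀ w, m ≤ w.length → S w = 0)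
    (hT : ∀ w, n ≤ w.length → T w = 0) (w : List (Fin 2)) (hw : m + n ≤ w.length) :
    (S * T) w = 0 := by
  induction w generalizing S T m n with
  | nil =>
    rw [mul_nil, hS [] (by simp at hw ⊢; omega), zero_mul]
  | cons a w ih =>
    rw [List.length_cons] at hw
    rw [mul_cons]
    have h1 : (resid a S * T) w = 0 := by
      cases m with
      | zero =>
        have : resid a S = 0 := NCSeries.ext fun v => hS _ (Nat.zero_le _)
        rw [this, zero_mul', zero_coeff]
      | succ m =>
        exact ih (m := m) (n := n) (fun v hv => hS (a :: v) (by simpa using hv)) hT (by omega)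
    have h2 : (S * resid a T) w = 0 := by
      cases n with
      | zero =>
        have : resid a T = 0 := NCSeries.ext fun v => hT _ (Nat.zero_le _)
        rw [this, NCSeries.mul_comm', zero_mul', zero_coeff]
      | succ n =>
        exact ih (m := m) (n := n) hS (fun v hv => hT (a :: v) (by simpa using hv)) (by omega)
    rw [h1, h2, add_zero]

theorem one_eq_word : (1 : Series) = word [] := by
  ext w
  cases w with
  | nil => simp [word]; rfl
  | cons a w => simp [word]; rfl

theorem word_mem_polynomials (w : List (Fin 2)) : (word w : Series) ∈ polynomials :=
  mem_polynomials_iff.2 ⟨w.length + 1, fun v hv => if_neg (by rintro rfl; omega)⟩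

/-- The noncommutative polynomials as a subalgebra of the shuffle algebra. -/
def polynomialSubalgebra : Subalgebra ℂ Series where
  carrier := polynomials
  mul_mem' := by
    intro S T hS hT
    obtain ⟨m, hm⟩ := mem_polynomials_iff.1 hS
    obtain ⟨n, hn⟩ := mem_polynomials_iff.1 hT
    exact mem_polynomials_iff.2 ⟨m + n, mul_eq_zero_of_length hm hn⟩
  add_mem' := by
    intro S T hS hT
    obtain ⟨m, hm⟩ := mem_polynomials_iff.1 hS
    obtain ⟨n, hn⟩ := mem_polynomials_iff.1 hT
    refine mem_polynomials_iff.2 ⟨m + n, fun w hw => ?_⟩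
    rw [add_coeff, hm w (by omega), hn w (by omega), add_zero]
  algebraMap_mem' c := by
    rw [Algebra.algebraMap_eq_smul_one, one_eq_word]
    obtain ⟨n, hn⟩ := mem_polynomials_iff.1 (word_mem_polynomials [])
    exact mem_polynomials_iff.2 ⟨n, fun w hw => by rw [smul_coeff, hn w hw, mul_zero]⟩

theorem resid_mem {S : Series} (hS : S ∈ polynomialSubalgebra) (a : Fin 2) :
    resid a S ∈ polynomialSubalgebra := by
  obtain ⟨n, hn⟩ := mem_polynomials_iff.1 hS
  exact mem_polynomials_iff.2 ⟨n, fun w hw => hn (a :: w) (by rw [List.length_cons]; omega)⟩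

/-- Taking a coefficient, as a linear form. -/
def coeffLinear (w : List (Fin 2)) : Series →ₗ[ℂ] ℂ where
  toFun S := S w
  map_add' _ _ := rfl
  map_smul' _ _ := rfl

theorem sum_coeff {ι : Type*} (s : Finset ι) (f : ι → Series) (w : List (Fin 2)) :
    (∑ i ∈ s, f i) w = ∑ i ∈ s, f i w :=
  map_sum (coeffLinear w) f s

theorem eq_sum_smul_word {S : Series} {s : Finset (List (Fin 2))} (hs : ∀ w, S w ≠ 0 → w ∈ s) :
    S = ∑ w ∈ s, S w • word w := by
  ext v
  rw [sum_coeff, Finset.sum_eq_single v]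
  · simp [smul_coeff, word]
  · intro w _ hw
    rw [smul_coeff, word, if_neg hw.symm, mul_zero]
  · intro h
    have h' : S v = 0 := by
      by_contra h'
      exact h (hs v h')
    rw [smul_coeff, h', zero_mul]

theorem exists_finset_support {S : Series} (hS : S ∈ polynomialSubalgebra) :
    ∃ s : Finset (List (Fin 2)), ∀ w, w ∈ s ↔ S w ≠ 0 :=
  ⟨Set.Finite.toFinset (s := {w | S w ≠ 0}) hS, fun _ => Set.Finite.mem_toFinset _⟩

/-- The membership hypotheses in `add` are there because `polyLi` is additive only on series for
which its defining sum is finite. -/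
theorem polynomial_induction {p : Series → Prop} (zero : p 0)
    (add : ∀ S ∈ polynomialSubalgebra, ∀ T ∈ polynomialSubalgebra, p S → p T → p (S + T))
    (smul_word : ∀ (c : ℂ) (w : List (Fin 2)), p (c • word w)) {S : Series}
    (hS : S ∈ polynomialSubalgebra) : p S := by
  have h (s : Finset (List (Fin 2))) : (∑ w ∈ s, S w • word w) ∈ polynomialSubalgebra ∧
      p (∑ w ∈ s, S w • word w) := by
    classical
    induction s using Finset.induction_on with
    | empty => exact ⟨zero_mem _, zero⟩
    | insert w s hw ih =>
      rw [Finset.sum_insert hw]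
      have h1 : S w • word w ∈ polynomialSubalgebra :=
        polynomialSubalgebra.smul_mem (word_mem_polynomials w) _
      exact ⟨add_mem h1 ih.1, add _ h1 _ ih.1 (smul_word _ _) ih.2⟩
  obtain ⟨s, hs⟩ := exists_finset_support hS
  rw [eq_sum_smul_word fun w => (hs w).2]
  exact (h _).2

/-- `Li_S = ∑_w ⟨S|w⟩ Li_w` for a noncommutative polynomial `S`. -/
noncomputable def polyLi (S : Series) (z : ℂ) : ℂ := ∑ᶠ w, S w * Li w z

theorem polyLi_eq_sum {S : Series} {s : Finset (List (Fin 2))} (hs : ∀ w, S w ≠ 0 → w ∈ s)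
    (z : ℂ) : polyLi S z = ∑ w ∈ s, S w * Li w z :=
  finsum_eq_sum_of_support_subset _ fun w hw => hs w (left_ne_zero_of_mul hw)

theorem polyLi_add {S T : Series} (hS : S ∈ polynomialSubalgebra)
    (hT : T ∈ polynomialSubalgebra) (z : ℂ) : polyLi (S + T) z = polyLi S z + polyLi T z := by
  simp only [polyLi, add_coeff, add_mul]
  exact finsum_add_distrib
    (Set.Finite.subset hS fun w hw => left_ne_zero_of_mul hw)
    (Set.Finite.subset hT fun w hw => left_ne_zero_of_mul hw)

theorem polyLi_smul (c : ℂ) (S : Series) (z : ℂ) : polyLi (c • S) z = c * polyLi S z := by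
  simp only [polyLi, smul_coeff, mul_assoc]
  by_cases hc : c = 0
  · simp [hc]
  · exact (smul_finsum c fun w => S w * Li w z).symm

theorem polyLi_zero (z : ℂ) : polyLi 0 z = 0 := by
  simp [polyLi, zero_coeff]

theorem polyLi_word (w : List (Fin 2)) (z : ℂ) : polyLi (word w) z = Li w z := by
  rw [polyLi_eq_sum (s := {w}) (fun v hv => by
    by_contra h
    exact hv (if_neg (by simpa using h)))]
  simp [word]

theorem resid_word_nil (a : Fin 2) : resid a (word [] : Series) = 0 := by
  ext v
  simp [resid, word, zero_coeff]

theorem resid_word_cons_self (a : Fin 2) (w : List (Fin 2)) :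
    resid a (word (a :: w) : Series) = word w := by
  ext v
  simp [resid, word]

theorem resid_word_cons_of_ne {a b : Fin 2} (h : a ≠ b) (w : List (Fin 2)) :
    resid a (word (b :: w) : Series) = 0 := by
  ext v
  simp [resid, word, h, zero_coeff]

/-- This turns `d/dz` into residuals. As residuals are derivations of the shuffle product, the
Leibniz rule holds on both sides of the shuffle relation. -/
theorem hasDerivAt_polyLi {S : Series} (hS : S ∈ polynomialSubalgebra) {z : ℂ}
    (hz : z ∈ cleftPlane) :
    HasDerivAt (polyLi S) (polyLi (resid 0 S) z / z + polyLi (resid 1 S) z / (1 - z)) z := by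
  refine polynomial_induction (p := fun S => HasDerivAt (polyLi S)
    (polyLi (resid 0 S) z / z + polyLi (resid 1 S) z / (1 - z)) z) ?_ ?_ ?_ hS
  · have h : polyLi (0 : Series) = fun _ => 0 := funext polyLi_zero
    rw [resid_zero, resid_zero, h]
    simpa using hasDerivAt_const z (0 : ℂ)
  · intro S hS T hT h1 h2
    have h : polyLi (S + T) = fun z => polyLi S z + polyLi T z := funext (polyLi_add hS hT)
    rw [h]
    refine (h1.fun_add h2).congr_deriv ?_
    rw [resid_add, resid_add, polyLi_add (resid_mem hS 0) (resid_mem hT 0),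
      polyLi_add (resid_mem hS 1) (resid_mem hT 1)]
    ring
  · intro c w
    have h : polyLi (c • word w : Series) = fun z => c * Li w z := by
      ext z
      rw [polyLi_smul, polyLi_word]
    rw [h, resid_smul, resid_smul, polyLi_smul, polyLi_smul]
    cases w with
    | nil =>
      rw [resid_word_nil, resid_word_nil, polyLi_zero]
      simpa [Li] using hasDerivAt_const z c
    | cons a w =>
      by_cases ha : a = 1
      · subst ha
        rw [resid_word_cons_self, resid_word_cons_of_ne (by decide), polyLi_zero, polyLi_word]
        refine ((hasDerivAt_Li_one_cons w hz).const_mul c).congr_deriv ?_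
        ring
      · obtain rfl : a = 0 := by omega
        rw [resid_word_cons_self, resid_word_cons_of_ne (by decide), polyLi_zero, polyLi_word]
        refine ((hasDerivAt_Li_zero_cons w hz).const_mul c).congr_deriv ?_
        ring

theorem word_replicate_mul (m n : ℕ) :
    (word (List.replicate m 0) * word (List.replicate n 0) : Series) =
      ((m + n).choose m : ℂ) • word (List.replicate (m + n) 0) := by
  induction h : m + n generalizing m n with
  | zero =>
    obtain ⟨rfl, rfl⟩ : m = 0 ∧ n = 0 := by omega
    simp [← one_eq_word]
  | succ k ih =>
    rcases m with _ | m
    · obtain rfl : n = k + 1 := by omega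
      simp [← one_eq_word]
    rcases n with _ | n
    · obtain rfl : m = k := by omega
      simp [← one_eq_word]
    refine series_ext_resid ?_ fun a => ?_
    · rw [mul_nil, smul_coeff]
      simp [word, List.replicate_succ]
    · rw [resid_mul, resid_smul]
      simp only [List.replicate_succ]
      by_cases ha : a = 0
      · subst ha
        simp only [resid_word_cons_self]
        rw [← List.replicate_succ, ih m (n + 1) (by omega), ← List.replicate_succ,
          ih (m + 1) n (by omega), ← add_smul, Nat.choose_succ_succ]
        push_cast
        rfl
      · simp [resid_word_cons_of_ne ha]

/-- The series vanishing on all powers of `x₀` form an ideal, since the residual by `x₀` preserves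
them. -/
theorem mul_replicate_zero_eq_zero {S : Series} (hS : ∀ n, S (List.replicate n 0) = 0)
    (T : Series) (n : ℕ) : (S * T) (List.replicate n 0) = 0 := by
  induction n generalizing S T with
  | zero => simpa [mul_nil] using Or.inl (hS 0)
  | succ n ih =>
    rw [List.replicate_succ, mul_cons, ih hS, ih fun n => hS (n + 1), add_zero]

theorem eq_replicate_zero {w : List (Fin 2)} (hw : 1 ∉ w) : w = List.replicate w.length 0 := by
  refine List.eq_replicate_iff.2 ⟨rfl, fun b hb => ?_⟩
  have : b ≠ 1 := fun h => hw (h ▸ hb)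
  omega

theorem word_replicate_zero_eq_zero {w : List (Fin 2)} (hw : 1 ∈ w) (n : ℕ) :
    (word w : Series) (List.replicate n 0) = 0 :=
  if_neg (by rintro rfl; simp at hw)

theorem polyLi_tendsto_zero {S : Series} (hS : S ∈ polynomialSubalgebra)
    (h : ∀ n, S (List.replicate n 0) = 0) {z : ℂ} (hz : z ∈ cleftPlane) :
    Tendsto (fun t : ℝ => polyLi S (t * z)) (𝓝[>] 0) (𝓝 0) := by
  obtain ⟨s, hs⟩ := exists_finset_support hS
  simp only [polyLi_eq_sum fun w => (hs w).2]
  have h1 : Tendsto (fun t : ℝ => ∑ w ∈ s, S w * Li w (t * z)) (𝓝[>] 0)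
      (𝓝 (∑ w ∈ s, (0 : ℂ))) := by
    refine tendsto_finsetSum s fun w hw => ?_
    have hw1 : 1 ∈ w := by
      by_contra hw1
      rw [hs, eq_replicate_zero hw1] at hw
      exact hw (h _)
    simpa only [mul_zero] using
      ((rayGrowth_Li_of_one_mem hw1).tendsto_zero (by norm_num) hz).const_mul (S w)
  rwa [Finset.sum_const_zero] at h1

/-- The shuffle relation `Li_{u ⧢ v} = Li_u Li_v`. -/
theorem polyLi_word_mul_word (u v : List (Fin 2)) {z : ℂ} (hz : z ∈ cleftPlane) :
    polyLi (word u * word v) z = Li u z * Li v z := by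
  have hmem (u v : List (Fin 2)) : (word u * word v : Series) ∈ polynomialSubalgebra :=
    mul_mem (word_mem_polynomials u) (word_mem_polynomials v)
  induction hn : u.length + v.length using Nat.strong_induction_on generalizing u v z with
  | _ n ih =>
  -- For two powers of `x₀` the limit at 0 is of no use (logarithms blow up), but the relation is
  -- the explicit identity `x₀^m ⧢ x₀^n = C(m+n, m) x₀^(m+n)`.
  by_cases huv : 1 ∉ u ∧ 1 ∉ v
  · rw [Li_of_one_notMem huv.1, Li_of_one_notMem huv.2, eq_replicate_zero huv.1,
      eq_replicate_zero huv.2, word_replicate_mul, polyLi_smul, polyLi_word,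
      Li_of_one_notMem (by simp)]
    simp only [List.length_replicate]
    have h1 := Nat.choose_mul_factorial_mul_factorial (Nat.le_add_right u.length v.length)
    rw [Nat.add_sub_cancel_left] at h1
    have h2 : ((u.length + v.length).choose u.length * u.length ! * v.length ! : ℂ) =
      (u.length + v.length)! := by exact_mod_cast h1
    have h3 : (u.length ! : ℂ) ≠ 0 := by exact_mod_cast u.length.factorial_ne_zero
    have h4 : (v.length ! : ℂ) ≠ 0 := by exact_mod_cast v.length.factorial_ne_zero
    have h5 : ((u.length + v.length)! : ℂ) ≠ 0 := by
      exact_mod_cast (u.length + v.length).factorial_ne_zero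
    rw [pow_add]
    field_simp
    rw [← h2]
    ring
  -- By induction on the total length, the difference of the two sides has derivative 0. It is
  -- therefore constant on `Ω`, and its limit along the ray to 0 identifies the constant.
  · have hderiv {z : ℂ} (hz : z ∈ cleftPlane) :
        HasDerivAt (fun z => polyLi (word u * word v) z - Li u z * Li v z) 0 z := by
      have hword (w : List (Fin 2)) := hasDerivAt_polyLi (word_mem_polynomials w) hz
      have hfun (w : List (Fin 2)) : polyLi (word w) = Li w := funext (polyLi_word w)
      have h1 := hword u
      have h2 := hword v
      rw [hfun] at h1 h2
      refine ((hasDerivAt_polyLi (hmem u v) hz).sub (h1.mul h2)).congr_deriv ?_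
      have hl (a : Fin 2) : polyLi (resid a (word u) * word v) z =
          polyLi (resid a (word u)) z * Li v z := by
        rcases u with _ | ⟨b, u⟩
        · rw [resid_word_nil, zero_mul, polyLi_zero, zero_mul]
        · by_cases hab : a = b
          · subst hab
            rw [resid_word_cons_self, polyLi_word]
            exact ih _ (by simp [← hn]) u v hz rfl
          · rw [resid_word_cons_of_ne hab, zero_mul, polyLi_zero, zero_mul]
      have hr (a : Fin 2) : polyLi (word u * resid a (word v)) z =
          Li u z * polyLi (resid a (word v)) z := by
        rcases v with _ | ⟨b, v⟩
        · rw [resid_word_nil, mul_zero, polyLi_zero, mul_zero]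
        · by_cases hab : a = b
          · subst hab
            rw [resid_word_cons_self, polyLi_word]
            exact ih _ (by simp [← hn]) u v hz rfl
          · rw [resid_word_cons_of_ne hab, mul_zero, polyLi_zero, mul_zero]
      have hm (a : Fin 2) : polyLi (resid a (word u * word v)) z =
          polyLi (resid a (word u)) z * Li v z + Li u z * polyLi (resid a (word v)) z := by
        rw [resid_mul, polyLi_add (mul_mem (resid_mem (word_mem_polynomials u) a)
          (word_mem_polynomials v)) (mul_mem (word_mem_polynomials u)
          (resid_mem (word_mem_polynomials v) a)), hl, hr]
      rw [hm, hm]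
      ring
    have hconst {x y : ℂ} (hx : x ∈ cleftPlane) (hy : y ∈ cleftPlane) :=
      isOpen_cleftPlane.is_const_of_deriv_eq_zero (𝕜 := ℂ) isPreconnected_cleftPlane
        (fun z hz => (hderiv hz).differentiableAt.differentiableWithinAt)
        (fun z hz => (hderiv hz).deriv) hx hy
    have hlim : Tendsto (fun t : ℝ => polyLi (word u * word v) (t * z) -
        Li u (t * z) * Li v (t * z)) (𝓝[>] 0) (𝓝 (0 - 0)) := by
      refine Tendsto.sub (polyLi_tendsto_zero (hmem u v) ?_ hz) ?_
      · intro n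
        by_cases hu : 1 ∈ u
        · exact mul_replicate_zero_eq_zero (word_replicate_zero_eq_zero hu) _ n
        · rw [mul_comm]
          exact mul_replicate_zero_eq_zero
            (word_replicate_zero_eq_zero (by tauto)) _ n
      -- The factor whose word contains `x₁` is `O(t^(3/4))`, which beats the `O(t^(-1/4))` of the
      -- other.
      · by_cases hu : 1 ∈ u
        · exact ((rayGrowth_Li_of_one_mem hu).mul (rayGrowth_Li v)).tendsto_zero (by norm_num) hz
        · exact ((rayGrowth_Li u).mul (rayGrowth_Li_of_one_mem (by tauto))).tendsto_zero
            (by norm_num) hz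
    have heq : Tendsto (fun t : ℝ => polyLi (word u * word v) (t * z) -
        Li u (t * z) * Li v (t * z)) (𝓝[>] 0)
        (𝓝 (polyLi (word u * word v) z - Li u z * Li v z)) := by
      refine tendsto_const_nhds.congr' ?_
      filter_upwards [Ioc_mem_nhdsGT (zero_lt_one' ℝ)] with t ht
      exact hconst hz (ofReal_mul_mem_cleftPlane hz ht.1 ht.2)
    have := tendsto_nhds_unique heq hlim
    rw [sub_zero] at this
    exact sub_eq_zero.1 this

theorem polyLi_mul {S T : Series} (hS : S ∈ polynomialSubalgebra)
    (hT : T ∈ polynomialSubalgebra) {z : ℂ} (hz : z ∈ cleftPlane) :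
    polyLi (S * T) z = polyLi S z * polyLi T z := by
  refine polynomial_induction (p := fun S => polyLi (S * T) z = polyLi S z * polyLi T z)
    ?_ ?_ ?_ hS
  · rw [zero_mul, polyLi_zero, zero_mul]
  · intro S hS S' hS' h h'
    rw [add_mul, polyLi_add (mul_mem hS hT) (mul_mem hS' hT), h, h', polyLi_add hS hS', add_mul]
  · intro c u
    rw [NCSeries.smul_mul', polyLi_smul, polyLi_smul, polyLi_word, mul_assoc]
    congr 1
    have hu := word_mem_polynomials u
    refine polynomial_induction (p := fun T => polyLi (word u * T) z = Li u z * polyLi T z)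
      ?_ ?_ ?_ hT
    · rw [mul_zero, polyLi_zero, mul_zero]
    · intro S hS S' hS' h h'
      rw [mul_add, polyLi_add (mul_mem hu hS) (mul_mem hu hS'), h, h', polyLi_add hS hS', mul_add]
    · intro c v
      rw [mul_comm, NCSeries.smul_mul', mul_comm, polyLi_smul, polyLi_smul, polyLi_word_mul_word u v hz,
        polyLi_word]
      ring

/-- The algebra morphism `S ↦ Li_S` on the noncommutative polynomials. -/
noncomputable def polyLiHom : polynomialSubalgebra →ₐ[ℂ] holo where
  toFun S := ⟨fun z => polyLi S.1 z, polyLi S.1, fun _ hz =>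
    (hasDerivAt_polyLi S.2 hz).differentiableAt.differentiableWithinAt, fun _ => rfl⟩
  map_one' := by
    ext z
    change polyLi 1 z = 1
    rw [one_eq_word, polyLi_word, Li]
  map_mul' S T := by
    ext z
    exact polyLi_mul S.2 T.2 z.2
  map_zero' := by
    ext z
    exact polyLi_zero _
  map_add' S T := by
    ext z
    exact polyLi_add S.2 T.2 z
  commutes' c := by
    ext z
    change polyLi (algebraMap ℂ Series c) z = c
    rw [Algebra.algebraMap_eq_smul_one, polyLi_smul, one_eq_word, polyLi_word, Li, mul_one]

/-! ### Stars as shuffle exponentials, and their independence over polynomials -/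

/-- The shuffle exponential `(a₀ x₀ + a₁ x₁)^*`. -/
noncomputable def starSeries (a : Fin 2 → ℂ) : Series := fun w => (w.map a).prod

theorem starSeries_nil (a : Fin 2 → ℂ) : starSeries a [] = 1 := rfl

theorem resid_starSeries (a : Fin 2 → ℂ) (i : Fin 2) :
    resid i (starSeries a) = a i • starSeries a := by
  ext w
  simp [resid, starSeries, smul_coeff]

theorem starSeries_mul (a b : Fin 2 → ℂ) :
    starSeries a * starSeries b = starSeries (a + b) := by
  ext w
  induction w with
  | nil => simp [mul_nil, starSeries_nil]
  | cons i w ih =>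
    rw [mul_cons, resid_starSeries, resid_starSeries, smul_mul_assoc, mul_smul_comm, smul_coeff,
      smul_coeff, ih, ← add_mul]
    simp [starSeries]

theorem starSeries_zero : starSeries 0 = 1 := by
  ext w
  cases w with
  | nil => rfl
  | cons i w => simp [starSeries]; rfl

theorem conc_smul_letter_nil (c : ℂ) (i : Fin 2) (T : Series) :
    conc (c • letter i) T [] = 0 := by
  simp [conc, smul_coeff, letter, word]

theorem conc_smul_letter_cons (c : ℂ) (i j : Fin 2) (T : Series) (w : List (Fin 2)) :
    conc (c • letter i) T (j :: w) = Pi.single (M := fun _ => ℂ) i c j * T w := by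
  -- Only the cut after the first letter has a one-letter prefix.
  rw [conc, Finset.sum_eq_single 1]
  · by_cases h : j = i
    · subst h
      simp [smul_coeff, letter, word]
    · simp [smul_coeff, letter, word, h]
  · intro k hk hk1
    rw [smul_coeff, letter, word, if_neg, mul_zero, zero_mul]
    intro h
    have := congrArg List.length h
    simp only [List.length_take, List.length_cons, List.length_nil, Finset.mem_range] at this hk
    omega
  · simp

theorem concPow_smul_letter (c : ℂ) (i : Fin 2) (k : ℕ) (w : List (Fin 2)) :
    concPow (c • letter i) k w =
      if w.length = k then starSeries (Pi.single i c) w else 0 := by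
  induction k generalizing w with
  | zero =>
    cases w with
    | nil => simp [concPow, NCSeries.unit, starSeries]
    | cons j w => simp [concPow, NCSeries.unit]
  | succ k ih =>
    cases w with
    | nil => simp [concPow, conc_smul_letter_nil]
    | cons j w =>
      rw [concPow, conc_smul_letter_cons, ih]
      simp [starSeries]

theorem kstar_smul_letter (c : ℂ) (i : Fin 2) :
    kstar (c • letter i) = starSeries (Pi.single i c) := by
  ext w
  simp [kstar, concPow_smul_letter]

theorem kstar_letter (i : Fin 2) : kstar (letter i) = starSeries (Pi.single i 1) := by
  rw [← kstar_smul_letter, one_smul]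

theorem kstar_neg_letter (i : Fin 2) : kstar (-letter i) = starSeries (Pi.single i (-1)) := by
  rw [← kstar_smul_letter, neg_one_smul]

/-- The derivation `x₀^{-1} + i x₁^{-1}` of the shuffle algebra. -/
noncomputable def residDer : Module.End ℂ Series where
  toFun S := resid 0 S + Complex.I • resid 1 S
  map_add' S T := by
    rw [resid_add, resid_add, smul_add]
    abel
  map_smul' c S := by
    rw [resid_smul, resid_smul, RingHom.id_apply, smul_add, smul_comm]

theorem residDer_mul (S T : Series) : residDer (S * T) = residDer S * T + S * residDer T := by
  change resid 0 (S * T) + Complex.I • resid 1 (S * T) = (resid 0 S + Complex.I • resid 1 S) * T +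
    S * (resid 0 T + Complex.I • resid 1 T)
  rw [resid_mul, resid_mul, smul_add, add_mul, mul_add, smul_mul_assoc, mul_smul_comm]
  abel

theorem residDer_starSeries (a : Fin 2 → ℂ) :
    residDer (starSeries a) = (a 0 + Complex.I * a 1) • starSeries a := by
  change resid 0 (starSeries a) + Complex.I • resid 1 (starSeries a) = _
  rw [resid_starSeries, resid_starSeries, smul_smul, add_smul]

/-- Each application lowers the bound on the lengths of the words by one. -/
theorem exists_residDer_pow_eq_zero {S : Series} (hS : S ∈ polynomialSubalgebra) :
    ∃ n, (residDer ^ n) S = 0 := by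
  obtain ⟨N, hN⟩ := mem_polynomials_iff.1 hS
  have h (n : ℕ) (w : List (Fin 2)) (hw : N ≤ w.length + n) : (residDer ^ n) S w = 0 := by
    induction n generalizing w with
    | zero => exact hN w hw
    | succ n ih =>
      rw [pow_succ', Module.End.mul_apply]
      change (residDer ^ n) S (0 :: w) + Complex.I * (residDer ^ n) S (1 :: w) = 0
      rw [ih _ (by rw [List.length_cons]; omega), ih _ (by rw [List.length_cons]; omega)]
      simp
  exact ⟨N, NCSeries.ext fun w => h N w (Nat.le_add_left _ _)⟩

/-- With `D = residDer` and `λ` the eigenvalue of the star `e`, Leibniz gives `(D - λ)(T e) = (D T)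
e`, and `D` is locally nilpotent on polynomials. -/
theorem mul_starSeries_mem_maxGenEigenspace {S : Series} (hS : S ∈ polynomialSubalgebra)
    (a : Fin 2 → ℂ) :
    S * starSeries a ∈ residDer.maxGenEigenspace (a 0 + Complex.I * a 1) := by
  rw [Module.End.mem_maxGenEigenspace]
  have h (n : ℕ) (T : Series) :
      ((residDer - (a 0 + Complex.I * a 1) • (1 : Module.End ℂ Series)) ^ n)
        (T * starSeries a) = (residDer ^ n) T * starSeries a := by
    induction n generalizing T with
    | zero => rfl
    | succ n ih =>
      rw [pow_succ, Module.End.mul_apply, pow_succ, Module.End.mul_apply, ← ih]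
      congr 1
      rw [LinearMap.sub_apply, residDer_mul, residDer_starSeries, LinearMap.smul_apply,
        Module.End.one_apply, mul_smul_comm, add_sub_cancel_right]
  obtain ⟨n, hn⟩ := exists_residDer_pow_eq_zero hS
  exact ⟨n, by rw [h, hn, zero_mul]⟩

theorem eq_zero_of_mul_starSeries_eq_zero {S : Series} {a : Fin 2 → ℂ}
    (h : S * starSeries a = 0) : S = 0 := by
  have h1 : S * starSeries a * starSeries (-a) = 0 := by rw [h, zero_mul]
  rwa [mul_assoc, starSeries_mul, add_neg_cancel, starSeries_zero, mul_one] at h1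

/-- The exponents of `(k x₀)^* ⧢ (l x₁)^*`. -/
def starExponent (p : ℤ × ℕ) : Fin 2 → ℂ := ![p.1, p.2]

theorem starExponent_add (p q : ℤ × ℕ) :
    starExponent (p + q) = starExponent p + starExponent q := by
  ext i
  fin_cases i <;> simp [starExponent]

/-- The terms lie in generalized eigenspaces for distinct eigenvalues, so each vanishes; stars are
invertible, so each coefficient vanishes. -/
theorem eq_zero_of_sum_mul_starSeries_eq_zero (s : Finset (ℤ × ℕ)) (f : ℤ × ℕ → Series)
    (hf : ∀ p ∈ s, f p ∈ polynomialSubalgebra)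
    (h : ∑ p ∈ s, f p * starSeries (starExponent p) = 0) : ∀ p ∈ s, f p = 0 := by
  -- The factor `i` in `residDer` lets a single eigenvalue `k + i l` remember both exponents.
  have hinj : Function.Injective fun p : ℤ × ℕ => (p.1 + Complex.I * p.2 : ℂ) := by
    rintro ⟨k, l⟩ ⟨k', l'⟩ h
    have h1 := congrArg Complex.re h
    have h2 := congrArg Complex.im h
    simp at h1 h2
    rw [h1, h2]
  have hind := (Module.End.independent_maxGenEigenspace residDer).comp hinj
  rw [iSupIndep_iff_finsetSum_eq_zero_imp_eq_zero] at hind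
  intro p hp
  exact eq_zero_of_mul_starSeries_eq_zero (hind s _
    (fun q hq => mul_starSeries_mem_maxGenEigenspace (hf q hq) (starExponent q)) h p hp)

/-! ### Wronskians and rational primitives -/

section Wronskian

open Polynomial

theorem exists_isCoprime_factorization {p : ℂ[X]} (hp : p ≠ 0) (q : ℂ[X]) :
    ∃ g p₁ q₁, g ≠ 0 ∧ p₁ ≠ 0 ∧ p = g * p₁ ∧ q = g * q₁ ∧ IsCoprime p₁ q₁ := by
  have hg : EuclideanDomain.gcd p q ≠ 0 := fun h => hp (EuclideanDomain.gcd_eq_zero_iff.1 h).1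
  obtain ⟨p₁, h1⟩ := EuclideanDomain.gcd_dvd_left p q
  obtain ⟨q₁, h2⟩ := EuclideanDomain.gcd_dvd_right p q
  refine ⟨_, p₁, q₁, hg, ?_, h1, h2, ?_⟩
  · rintro rfl
    exact hp (by rw [h1, mul_zero])
  · refine ⟨EuclideanDomain.gcdA p q, EuclideanDomain.gcdB p q, mul_left_cancel₀ hg ?_⟩
    have h3 := EuclideanDomain.gcd_eq_gcd_ab p q
    set g := EuclideanDomain.gcd p q
    set A := EuclideanDomain.gcdA p q
    set B := EuclideanDomain.gcdB p q
    calc g * (A * p₁ + B * q₁) = (g * p₁) * A + (g * q₁) * B := by ring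
      _ = g * 1 := by rw [← h1, ← h2, ← h3, mul_one]

/-- This says that `(q/p)' = 0` makes `q/p` constant. In lowest terms, a vanishing Wronskian forces
both derivatives to vanish. -/
theorem exists_eq_C_mul_of_wronskian_eq_zero {p q : ℂ[X]} (hp : p ≠ 0)
    (h : p * derivative q - derivative p * q = 0) : ∃ c, q = C c * p := by
  obtain ⟨g, p₁, q₁, hg, hp₁, rfl, rfl, hcop⟩ := exists_isCoprime_factorization hp q
  have h1 : wronskian p₁ q₁ = 0 := by
    refine (mul_eq_zero.1 (?_ : g ^ 2 * wronskian p₁ q₁ = 0)).resolve_left (pow_ne_zero 2 hg)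
    rw [← h]
    simp only [wronskian, derivative_mul]
    ring
  obtain ⟨h2, h3⟩ := hcop.wronskian_eq_zero_iff.1 h1
  obtain ⟨u, rfl⟩ := natDegree_eq_zero.1 (derivative_eq_zero.1 h2)
  obtain ⟨v, rfl⟩ := natDegree_eq_zero.1 (derivative_eq_zero.1 h3)
  have hu : u ≠ 0 := by
    rintro rfl
    exact hp₁ C_0
  refine ⟨v / u, ?_⟩
  rw [mul_left_comm, ← C_mul, div_mul_cancel₀ v hu]

/-- No combination of `1 / z` and `1 / (1 - z)` has a rational primitive. -/
theorem eq_zero_of_rational_primitive {p q : ℂ[X]} (hp : p ≠ 0) {c d : ℂ}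
    (h : X * (1 - X) * (p * derivative q - derivative p * q) +
      p ^ 2 * (C c * (1 - X) + C d * X) = 0) : c = 0 ∧ d = 0 := by
  -- The hypothesis is `(q/p)' + c/z + d/(1-z) = 0` with denominators cleared; `q/p` is now put in
  -- lowest terms.
  obtain ⟨g, p₁, q₁, hg, hp₁, rfl, rfl, hcop⟩ := exists_isCoprime_factorization hp q
  have h1 : X * (1 - X) * (p₁ * derivative q₁ - derivative p₁ * q₁) +
      p₁ ^ 2 * (C c * (1 - X) + C d * X) = 0 := by
    refine (mul_eq_zero.1 (?_ : g ^ 2 * _ = 0)).resolve_left (pow_ne_zero 2 hg)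
    rw [← h]
    simp only [derivative_mul]
    ring
  -- A root of `p₁` of order `k + 1` would be a pole of `(q/p)'` of order `k + 2 ≥ 2`, whereas `c/z
  -- + d/(1-z)` has at most simple poles. Algebraically, `(X - a)^2` would divide the squarefree
  -- polynomial `X(1 - X)`.
  have hroot (a : ℂ) : ¬ p₁.IsRoot a := by
    intro ha
    obtain ⟨s, hs, hs'⟩ := exists_eq_pow_rootMultiplicity_mul_and_not_dvd p₁ hp₁ a
    obtain ⟨k, hk⟩ := Nat.exists_eq_succ_of_ne_zero
      ((rootMultiplicity_pos hp₁).2 ha).ne'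
    rw [hk] at hs
    have hXa : (X - C a : ℂ[X]) ≠ 0 := X_sub_C_ne_zero a
    have h2 : X * (1 - X) * ((X - C a) * (s * derivative q₁ - derivative s * q₁) -
        ((k + 1 : ℕ) : ℂ[X]) * (s * q₁)) =
        (X - C a) ^ 2 * (-(X - C a) ^ k * s ^ 2 * (C c * (1 - X) + C d * X)) := by
      refine mul_left_cancel₀ (pow_ne_zero k hXa) ?_
      rw [hs] at h1
      simp only [derivative_mul, derivative_pow, derivative_sub, derivative_X, derivative_C,
        Nat.succ_eq_add_one, Nat.add_sub_cancel, C_eq_natCast] at h1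
      linear_combination h1
    have h3 : ¬ (X - C a) ∣ ((X - C a) * (s * derivative q₁ - derivative s * q₁) -
        ((k + 1 : ℕ) : ℂ[X]) * (s * q₁)) := by
      intro h3
      rw [dvd_iff_isRoot] at hs' h3
      have hq : q₁.eval a ≠ 0 := by
        intro hq
        obtain ⟨A, B, hAB⟩ := hcop
        have := congrArg (eval a) hAB
        rw [eval_add, eval_mul, eval_mul, hq, ha] at this
        simp at this
      simp only [IsRoot.def, eval_sub, eval_mul, eval_X, eval_C, sub_self, zero_mul,
        eval_natCast, zero_sub, neg_eq_zero, mul_eq_zero, Nat.cast_eq_zero] at h3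
      rcases h3 with h3 | h3 | h3
      · omega
      · exact hs' h3
      · exact hq h3
    have h4 : (X - C a) ^ 2 ∣ (X * (1 - X) : ℂ[X]) := by
      refine IsCoprime.dvd_of_dvd_mul_right ?_ (Dvd.intro _ h2.symm)
      exact (((irreducible_X_sub_C a).coprime_iff_not_dvd).2 h3).pow_left
    obtain ⟨r, hr⟩ := h4
    have h5 := congrArg (eval a) hr
    have h6 := congrArg (fun f => eval a (derivative f)) hr
    simp [derivative_mul, derivative_pow] at h5 h6
    rcases h5 with h5 | h5
    · simp [h5] at h6
    · rw [h5] at h6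
      have : a = 1 := (sub_eq_zero.1 h5).symm
      simp [this] at h6
  have hdeg : p₁.degree ≤ 0 := by
    by_contra hdeg
    obtain ⟨a, ha⟩ := Complex.exists_root (not_le.1 hdeg)
    exact hroot a ha
  obtain ⟨u, rfl⟩ : ∃ u, p₁ = C u := ⟨_, eq_C_of_degree_le_zero hdeg⟩
  have hu : u ≠ 0 := by
    rintro rfl
    exact hp₁ C_0
  -- With `p₁` a nonzero constant, evaluation at 0 isolates `c` and evaluation at 1 isolates `d`.
  have h0 := congrArg (eval 0) h1
  have h1 := congrArg (eval 1) h1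
  simp [hu] at h0 h1
  exact ⟨h0, h1⟩

end Wronskian

/-! ### Linear independence of the polylogarithms over `ℂ[z]` -/

section LinearIndependence

open Polynomial

/-- The value at `z` of a family of polynomial coefficients. -/
noncomputable def specialize (P : List (Fin 2) → ℂ[X]) (z : ℂ) : Series := fun w => (P w).eval z

theorem specialize_mem {P : List (Fin 2) → ℂ[X]} {n : ℕ} (hP : ∀ w, n ≤ w.length → P w = 0)
    (z : ℂ) : specialize P z ∈ polynomialSubalgebra :=
  mem_polynomials_iff.2 ⟨n, fun w hw => by simp [specialize, hP w hw]⟩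

theorem hasDerivAt_polyLi_specialize {P : List (Fin 2) → ℂ[X]} {n : ℕ}
    (hP : ∀ w, n ≤ w.length → P w = 0) {z : ℂ} (hz : z ∈ cleftPlane) :
    HasDerivAt (fun y => polyLi (specialize P y) y)
      (polyLi (specialize (fun w => derivative (P w)) z) z +
        (polyLi (resid 0 (specialize P z)) z / z +
          polyLi (resid 1 (specialize P z)) z / (1 - z))) z := by
  obtain ⟨s, hs⟩ : ∃ s : Finset (List (Fin 2)), ∀ w, w.length < n → w ∈ s :=
    ⟨(List.finite_length_lt (Fin 2) n).toFinset, fun w hw => by simpa using hw⟩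
  have hs' {w : List (Fin 2)} (hw : P w ≠ 0) : w ∈ s := by
    refine hs w ?_
    by_contra h
    exact hw (hP w (not_lt.1 h))
  have hsum (S : ℂ → Series) (hS : ∀ y w, S y w ≠ 0 → P w ≠ 0) :
      (fun y => polyLi (S y) y) = fun y => ∑ w ∈ s, S y w * Li w y :=
    funext fun y => polyLi_eq_sum (fun w hw => hs' (hS y w hw)) y
  have hspec (y : ℂ) (w : List (Fin 2)) (hw : specialize P y w ≠ 0) : P w ≠ 0 := by
    intro h
    exact hw (by simp [specialize, h])
  have hLi (w : List (Fin 2)) : HasDerivAt (Li w) (deriv (Li w) z) z :=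
    ((differentiableOn_Li w).differentiableAt (isOpen_cleftPlane.mem_nhds hz)).hasDerivAt
  have h1 : HasDerivAt (polyLi (specialize P z)) (∑ w ∈ s, (P w).eval z * deriv (Li w) z) z := by
    have h2 := hsum (fun _ => specialize P z) fun _ => hspec z
    change polyLi (specialize P z) = _ at h2
    rw [h2]
    exact HasDerivAt.fun_sum fun w _ => (hLi w).const_mul _
  rw [hsum _ hspec, ← h1.unique (hasDerivAt_polyLi (specialize_mem hP z) hz)]
  have h3 : polyLi (specialize (fun w => derivative (P w)) z) z =
      ∑ w ∈ s, (derivative (P w)).eval z * Li w z :=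
    polyLi_eq_sum (fun w hw => hs' fun h => hw (by simp [specialize, h])) z
  rw [h3, ← Finset.sum_add_distrib]
  exact HasDerivAt.fun_sum fun w _ => ((P w).hasDerivAt z).mul (hLi w)

theorem eq_zero_of_eval_eq_zero_on_cleftPlane {p : ℂ[X]} (h : ∀ z ∈ cleftPlane, p.eval z = 0) :
    p = 0 := by
  refine eq_zero_of_infinite_isRoot p (Set.Infinite.mono (s := cleftPlane) h ?_)
  exact infinite_of_mem_nhds _ (isOpen_cleftPlane.mem_nhds half_mem_cleftPlane)

/-- `z (1 - z) d/dz` on the coefficients of a combination of polylogarithms. -/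
noncomputable def coeffDeriv (P : List (Fin 2) → ℂ[X]) (w : List (Fin 2)) : ℂ[X] :=
  X * (1 - X) * derivative (P w) + (1 - X) * P (0 :: w) + X * P (1 :: w)

/-- Differentiating a relation yields a relation; the factor `z(1 - z)` keeps its coefficients
polynomial. -/
theorem polyLi_specialize_coeffDeriv {P : List (Fin 2) → ℂ[X]} {n : ℕ}
    (hP : ∀ w, n ≤ w.length → P w = 0) (h : ∀ z ∈ cleftPlane, polyLi (specialize P z) z = 0)
    {z : ℂ} (hz : z ∈ cleftPlane) : polyLi (specialize (coeffDeriv P) z) z = 0 := by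
  have h1 : HasDerivAt (fun y => polyLi (specialize P y) y) 0 z :=
    (hasDerivAt_const z (0 : ℂ)).congr_of_eventuallyEq
      (Filter.eventuallyEq_of_mem (isOpen_cleftPlane.mem_nhds hz) h)
  have h2 := (hasDerivAt_polyLi_specialize hP hz).unique h1
  have h3 : specialize (coeffDeriv P) z = (z * (1 - z)) • specialize (fun w => derivative (P w)) z +
      ((1 - z) • resid 0 (specialize P z) + z • resid 1 (specialize P z)) := by
    ext w
    simp only [add_coeff, smul_coeff, specialize, coeffDeriv, resid, eval_add, eval_mul, eval_X,
      eval_sub, eval_one]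
    ring
  have hm := specialize_mem hP z
  have hd : specialize (fun w => derivative (P w)) z ∈ polynomialSubalgebra :=
    specialize_mem (n := n) (fun w hw => by rw [hP w hw, derivative_zero]) z
  have m0 := polynomialSubalgebra.smul_mem (resid_mem hm 0) (1 - z)
  have m1 := polynomialSubalgebra.smul_mem (resid_mem hm 1) z
  rw [h3, polyLi_add (polynomialSubalgebra.smul_mem hd _) (add_mem m0 m1), polyLi_add m0 m1,
    polyLi_smul, polyLi_smul, polyLi_smul]
  have hz0 := ne_zero_of_mem_cleftPlane hz
  have hz1 := one_sub_ne_zero_of_mem_cleftPlane hz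
  field_simp at h2
  linear_combination h2

/-- The polylogarithms are linearly independent over `ℂ[z]`. -/
theorem eq_zero_of_polyLi_specialize_eq_zero {n : ℕ} {P : List (Fin 2) → ℂ[X]}
    (hP : ∀ w, n ≤ w.length → P w = 0) (h : ∀ z ∈ cleftPlane, polyLi (specialize P z) z = 0) :
    P = 0 := by
  induction n generalizing P with
  | zero => exact funext fun w => hP w (Nat.zero_le _)
  | succ n ihn =>
  -- Double induction: on the maximal length of the words, then on the number of nonzero
  -- coefficients at that length.
  induction hk : {w | w.length = n ∧ P w ≠ 0}.ncard using Nat.strong_induction_on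
    generalizing P with
  | _ k ihk =>
  by_cases htop : ∀ w, w.length = n → P w = 0
  · refine ihn (fun w hw => ?_) h
    rcases hw.eq_or_lt with hw | hw
    · exact htop w hw.symm
    · exact hP w hw
  exfalso
  push Not at htop
  obtain ⟨w₀, hw₀, hp⟩ := htop
  set p := P w₀ with hpdef
  have hQ0 (w : List (Fin 2)) (hw : n ≤ w.length) :
      coeffDeriv P w = X * (1 - X) * derivative (P w) := by
    rw [coeffDeriv, hP (0 :: w) (by simpa using hw), hP (1 :: w) (by simpa using hw)]
    ring
  -- Up to the factor `X(1 - X) p^2`, this is the derivative of the relation divided by `p`. Its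
  -- coefficient at `w₀` vanishes and no new top coefficient appears, so the inner induction gives
  -- `R = 0`.
  let R : List (Fin 2) → ℂ[X] := fun w => p * coeffDeriv P w - X * (1 - X) * derivative p * P w
  have hRtop (w : List (Fin 2)) (hw : n ≤ w.length) :
      R w = X * (1 - X) * (p * derivative (P w) - derivative p * P w) := by
    simp only [R, hQ0 w hw]
    ring
  have hRzero (w : List (Fin 2)) (hw : n ≤ w.length) (h0 : P w = 0) : R w = 0 := by
    rw [hRtop w hw, h0, derivative_zero]
    ring
  have hR : ∀ w, n + 1 ≤ w.length → R w = 0 := fun w hw => hRzero w (by omega) (hP w hw)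
  have hRrel : ∀ z ∈ cleftPlane, polyLi (specialize R z) z = 0 := by
    intro z hz
    have h1 : specialize R z = p.eval z • specialize (coeffDeriv P) z +
        (-(X * (1 - X) * derivative p).eval z) • specialize P z := by
      ext w
      simp only [add_coeff, smul_coeff, specialize, R, eval_sub, eval_mul]
      ring
    have hmQ : specialize (coeffDeriv P) z ∈ polynomialSubalgebra :=
      specialize_mem (n := n + 1) (fun w hw => by
        rw [hQ0 w (by omega), hP w hw, derivative_zero, mul_zero]) z
    rw [h1, polyLi_add (polynomialSubalgebra.smul_mem hmQ _)
      (polynomialSubalgebra.smul_mem (specialize_mem hP z) _), polyLi_smul, polyLi_smul, h z hz,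
      polyLi_specialize_coeffDeriv hP h hz, mul_zero, mul_zero, add_zero]
  have hR0 : R = 0 := by
    refine ihk _ ?_ hR hRrel rfl
    rw [← hk]
    have hfin : {w | w.length = n ∧ P w ≠ 0}.Finite :=
      (List.finite_length_le (Fin 2) n).subset fun w hw => hw.1.le
    refine Set.ncard_lt_ncard ⟨fun w hw => ⟨hw.1, fun h0 => hw.2 (hRzero w hw.1.ge h0)⟩, ?_⟩ hfin
    intro hsub
    refine (hsub ⟨hw₀, hp⟩).2 ?_
    rw [hRtop w₀ hw₀.ge, ← hpdef]
    ring
  have hX : (X * (1 - X) : ℂ[X]) ≠ 0 := by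
    refine mul_ne_zero X_ne_zero fun h0 => ?_
    simpa using congrArg (eval 0) h0
  -- At top length the coefficients of `R` are Wronskians with `p`, up to `X(1 - X)`.
  have hprop (w : List (Fin 2)) (hw : w.length = n) : ∃ c, P w = C c * p := by
    have h1 := hRtop w hw.ge
    rw [hR0, Pi.zero_apply] at h1
    exact exists_eq_C_mul_of_wronskian_eq_zero hp ((mul_eq_zero.1 h1.symm).resolve_left hX)
  rcases w₀ with _ | ⟨a, v⟩
  · refine hp (eq_zero_of_eval_eq_zero_on_cleftPlane fun z hz => ?_)
    have h1 := h z hz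
    rw [polyLi_eq_sum (s := {[]})] at h1
    · simpa [specialize, Li] using h1
    · intro w hw
      by_contra hw'
      have hl : 0 < w.length := List.length_pos_iff.2 (by simpa using hw')
      refine hw ?_
      rw [specialize, hP w (by rw [← hw₀, List.length_nil, zero_add]; exact hl), eval_zero]
  · rw [List.length_cons] at hw₀
    obtain ⟨c, hc⟩ := hprop (0 :: v) (by simpa using hw₀)
    obtain ⟨d, hd⟩ := hprop (1 :: v) (by simpa using hw₀)
    -- One level below the top, this coefficient says that `-P v / p` is a rational primitive of
    -- `c/z + d/(1-z)`. Hence `c = d = 0`, contradicting `p ≠ 0`.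
    have h1 : R v = 0 := congrFun hR0 v
    obtain ⟨hc0, hd0⟩ := eq_zero_of_rational_primitive (q := P v) hp (c := c) (d := d) (by
      simp only [R, coeffDeriv, hc, hd] at h1
      linear_combination h1)
    refine hp ?_
    rw [hpdef]
    by_cases ha : a = 0
    · rw [ha, hc, hc0, C_0, zero_mul]
    · obtain rfl : a = 1 := by omega
      rw [hd, hd0, C_0, zero_mul]

end LinearIndependence

/-! ### The free description of `starAlgebra` and the construction of the morphism -/

section Parametrization

/-- `(k, l) ↦ (k x₀)^* ⧢ (l x₁)^*`. -/
noncomputable def starMonomial : Multiplicative (ℤ × ℕ) →* Series where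
  toFun p := starSeries (starExponent p.toAdd)
  map_one' := by
    rw [← starSeries_zero]
    congr 1
    ext i
    fin_cases i <;> simp [starExponent]
  map_mul' p q := by rw [toAdd_mul, starExponent_add, starSeries_mul]

/-- `(k, l) ↦ z^k (1 - z)^{-l}`. -/
noncomputable def ratMonomial : Multiplicative (ℤ × ℕ) →* holo where
  toFun p := ⟨fun z => (z : ℂ) ^ p.toAdd.1 * ((1 - (z : ℂ))⁻¹) ^ p.toAdd.2,
    fun z => z ^ p.toAdd.1 * ((1 - z)⁻¹) ^ p.toAdd.2,
    (fun z hz => ((differentiableAt_zpow.2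
      (Or.inl (ne_zero_of_mem_cleftPlane hz))).mul (((differentiableAt_const _).sub
      differentiableAt_id).inv (one_sub_ne_zero_of_mem_cleftPlane hz) |>.pow
      _)).differentiableWithinAt), fun _ => rfl⟩
  map_one' := by
    ext z
    simp
  map_mul' p q := by
    ext z
    have hz := ne_zero_of_mem_cleftPlane z.2
    change (z : ℂ) ^ (p.toAdd.1 + q.toAdd.1) * ((1 - (z : ℂ))⁻¹) ^ (p.toAdd.2 + q.toAdd.2) =
      (z : ℂ) ^ p.toAdd.1 * ((1 - (z : ℂ))⁻¹) ^ p.toAdd.2 *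
        ((z : ℂ) ^ q.toAdd.1 * ((1 - (z : ℂ))⁻¹) ^ q.toAdd.2)
    rw [zpow_add₀ hz, pow_add]
    ring

/-- Combinations of the `(k x₀)^* ⧢ (l x₁)^*` with noncommutative polynomials as coefficients. -/
abbrev StarCombination : Type := AddMonoidAlgebra polynomialSubalgebra (ℤ × ℕ)

/-- The series represented by a combination of the `(k x₀)^* ⧢ (l x₁)^*`. -/
noncomputable def toSeries : StarCombination →ₐ[ℂ] Series :=
  AddMonoidAlgebra.liftNCAlgHom polynomialSubalgebra.val starMonomial fun _ _ => Commute.all _ _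

/-- The function represented by a combination of the `z^k (1 - z)^{-l}`. -/
noncomputable def toHolo : StarCombination →ₐ[ℂ] holo :=
  AddMonoidAlgebra.liftNCAlgHom polyLiHom ratMonomial fun _ _ => Commute.all _ _

theorem toSeries_single (p : ℤ × ℕ) (S : polynomialSubalgebra) :
    toSeries (AddMonoidAlgebra.single p S) = S.1 * starSeries (starExponent p) :=
  AddMonoidAlgebra.liftNC_single _ _ _ _

theorem toHolo_single (p : ℤ × ℕ) (S : polynomialSubalgebra) (z : cleftPlane) :
    (toHolo (AddMonoidAlgebra.single p S)).1 z =
      polyLi S.1 z * ((z : ℂ) ^ p.1 * ((1 - (z : ℂ))⁻¹) ^ p.2) := by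
  have h : toHolo (AddMonoidAlgebra.single p S) =
      polyLiHom S * ratMonomial (Multiplicative.ofAdd p) :=
    AddMonoidAlgebra.liftNC_single _ _ _ _
  rw [h]
  rfl

theorem toSeries_injective : Function.Injective toSeries := by
  rw [injective_iff_map_eq_zero]
  intro x hx
  have h1 : toSeries x =
      ∑ p ∈ x.coeff.support, (x.coeff p).1 * starSeries (starExponent p) := by
    conv_lhs => rw [← AddMonoidAlgebra.sum_coeff_single x]
    rw [Finsupp.sum, map_sum]
    exact Finset.sum_congr rfl fun p _ => toSeries_single p _
  rw [h1] at hx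
  have h2 := eq_zero_of_sum_mul_starSeries_eq_zero _ _ (fun p _ => (x.coeff p).2) hx
  rw [← AddMonoidAlgebra.coeff_eq_zero, ← Finsupp.support_eq_empty, Finset.eq_empty_iff_forall_notMem]
  intro p hp
  exact Finsupp.mem_support_iff.1 hp (Subtype.ext (h2 p hp))

theorem starSeries_nsmul (n : ℕ) (a : Fin 2 → ℂ) : starSeries (n • a) = starSeries a ^ n := by
  induction n with
  | zero => rw [zero_smul, starSeries_zero, pow_zero]
  | succ n ih => rw [succ_nsmul, ← starSeries_mul, ih, pow_succ]

theorem polynomials_subset_starAlgebra {S : Series} (hS : S ∈ polynomialSubalgebra) :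
    S ∈ starAlgebra :=
  Algebra.subset_adjoin (Or.inl hS)

theorem x0Star_coe : (x0Star : Series) = starSeries (starExponent (1, 0)) := by
  refine (kstar_letter 0).trans ?_
  congr 1
  ext i
  fin_cases i <;> simp [starExponent]

theorem negX0Star_coe : (negX0Star : Series) = starSeries (starExponent (-1, 0)) := by
  refine (kstar_neg_letter 0).trans ?_
  congr 1
  ext i
  fin_cases i <;> simp [starExponent]

theorem x1Star_coe : (x1Star : Series) = starSeries (starExponent (0, 1)) := by
  refine (kstar_letter 1).trans ?_
  congr 1
  ext i
  fin_cases i <;> simp [starExponent]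

theorem starSeries_mem_starAlgebra (p : ℤ × ℕ) :
    starSeries (starExponent p) ∈ starAlgebra := by
  obtain ⟨k, l⟩ := p
  have h1 : starSeries (starExponent (0, l)) ∈ starAlgebra := by
    have : starExponent (0, l) = l • starExponent (0, 1) := by
      ext i
      fin_cases i <;> simp [starExponent]
    rw [this, starSeries_nsmul, ← x1Star_coe]
    exact pow_mem x1Star.2 _
  have h0 : starSeries (starExponent (k, 0)) ∈ starAlgebra := by
    obtain ⟨n, rfl | rfl⟩ := k.eq_nat_or_neg
    · have : starExponent (n, 0) = n • starExponent (1, 0) := by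
        ext i
        fin_cases i <;> simp [starExponent]
      rw [this, starSeries_nsmul, ← x0Star_coe]
      exact pow_mem x0Star.2 _
    · have : starExponent (-n, 0) = n • starExponent (-1, 0) := by
        ext i
        fin_cases i <;> simp [starExponent]
      rw [this, starSeries_nsmul, ← negX0Star_coe]
      exact pow_mem negX0Star.2 _
  have h2 := mul_mem h0 h1
  rwa [starSeries_mul, ← starExponent_add, Prod.mk_add_mk, add_zero, zero_add] at h2

theorem toSeries_mem (x : StarCombination) : toSeries x ∈ starAlgebra := by
  induction x using AddMonoidAlgebra.induction_linear with
  | zero => rw [map_zero]; exact zero_mem _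
  | add x y hx hy => rw [map_add]; exact add_mem hx hy
  | single p S =>
    rw [toSeries_single]
    exact mul_mem (polynomials_subset_starAlgebra S.2) (starSeries_mem_starAlgebra p)

/-- The range of `toSeries` is a subalgebra containing all generators. -/
theorem exists_toSeries_eq {S : Series} (hS : S ∈ starAlgebra) : ∃ x, toSeries x = S := by
  have h : starAlgebra ≤ toSeries.range := by
    refine Algebra.adjoin_le ?_
    have hstar (p : ℤ × ℕ) : starSeries (starExponent p) ∈ toSeries.range :=
      ⟨AddMonoidAlgebra.single p 1, by
        rw [AlgHom.toRingHom_eq_coe, RingHom.coe_coe, toSeries_single]; exact one_mul _⟩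
    rintro T (hT | rfl | rfl | rfl)
    · refine ⟨AddMonoidAlgebra.single 0 ⟨T, hT⟩, ?_⟩
      have h0 : starExponent 0 = 0 := by
        ext i
        fin_cases i <;> simp [starExponent]
      rw [AlgHom.toRingHom_eq_coe, RingHom.coe_coe, toSeries_single, h0, starSeries_zero, mul_one]
    · exact Set.mem_of_eq_of_mem x0Star_coe (hstar (1, 0))
    · exact Set.mem_of_eq_of_mem x1Star_coe (hstar (0, 1))
    · exact Set.mem_of_eq_of_mem negX0Star_coe (hstar (-1, 0))
  exact h hS

/-- `starAlgebra` is free over the noncommutative polynomials on the `(k x₀)^* ⧢ (l x₁)^*`. -/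
noncomputable def starEquiv : StarCombination ≃ₐ[ℂ] starAlgebra :=
  AlgEquiv.ofBijective (toSeries.codRestrict starAlgebra toSeries_mem)
    ⟨fun _ _ h => toSeries_injective (congrArg Subtype.val h), fun S => by
      obtain ⟨x, hx⟩ := exists_toSeries_eq S.2
      exact ⟨x, Subtype.ext hx⟩⟩

/-- The morphism `Li^{(1)}`. -/
noncomputable def liOne : starAlgebra →ₐ[ℂ] holo := toHolo.comp starEquiv.symm.toAlgHom

theorem liOne_eq {S : starAlgebra} {x : StarCombination} (h : toSeries x = S.1) :
    liOne S = toHolo x := by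
  have : starEquiv x = S := Subtype.ext h
  rw [← this]
  exact congrArg toHolo (starEquiv.symm_apply_apply x)

theorem liOne_mul_starSeries {S : starAlgebra} (T : polynomialSubalgebra) (p : ℤ × ℕ)
    (h : S.1 = T.1 * starSeries (starExponent p)) (z : cleftPlane) :
    (liOne S).1 z = polyLi T.1 z * ((z : ℂ) ^ p.1 * ((1 - (z : ℂ))⁻¹) ^ p.2) := by
  rw [liOne_eq ((toSeries_single p T).trans h.symm), toHolo_single]

theorem liOne_polynomial (T : polynomialSubalgebra) (z : cleftPlane) :
    (liOne ⟨T.1, polynomials_subset_starAlgebra T.2⟩).1 z = polyLi T.1 z := by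
  rw [liOne_mul_starSeries T 0]
  · simp
  · have h0 : starExponent 0 = 0 := by
      ext i
      fin_cases i <;> simp [starExponent]
    rw [h0, starSeries_zero, mul_one]

theorem liOne_starSeries {S : starAlgebra} (p : ℤ × ℕ)
    (h : S.1 = starSeries (starExponent p)) (z : cleftPlane) :
    (liOne S).1 z = (z : ℂ) ^ p.1 * ((1 - (z : ℂ))⁻¹) ^ p.2 := by
  rw [liOne_mul_starSeries 1 p (h.trans (one_mul _).symm)]
  change polyLi 1 z * _ = _
  rw [one_eq_word, polyLi_word, Li, one_mul]

theorem isLiOne_liOne : IsLiOne liOne where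
  map_word w z := (liOne_polynomial ⟨word w, word_mem_polynomials w⟩ z).trans (polyLi_word w z)
  map_x0Star z := (liOne_starSeries _ x0Star_coe z).trans (by simp)
  map_negX0Star z := (liOne_starSeries _ negX0Star_coe z).trans (by simp)
  map_x1Star z := (liOne_starSeries _ x1Star_coe z).trans (by simp)

end Parametrization

/-! ### Uniqueness -/

theorem IsLiOne.eq {ν μ : starAlgebra →ₐ[ℂ] holo} (hν : IsLiOne ν) (hμ : IsLiOne μ) : ν = μ := by
  refine AlgHom.adjoin_ext ?_
  rintro S (hS | rfl | rfl | rfl)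
  · refine polynomial_induction (p := fun S => ∀ h : S ∈ starAlgebra, ν ⟨S, h⟩ = μ ⟨S, h⟩)
      ?_ ?_ ?_ hS _
    · exact fun h => (map_zero ν).trans (map_zero μ).symm
    · intro S hS T hT h1 h2 h
      have hS' := polynomials_subset_starAlgebra hS
      have hT' := polynomials_subset_starAlgebra hT
      have h3 : (⟨S + T, h⟩ : starAlgebra) = ⟨S, hS'⟩ + ⟨T, hT'⟩ := rfl
      rw [h3, map_add, map_add, h1, h2]
    · intro c w h
      have h3 : (⟨c • word w, h⟩ : starAlgebra) = c • wordElt w := rfl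
      rw [h3, map_smul, map_smul]
      congr 1
      ext z
      rw [hν.map_word, hμ.map_word]
  · exact Subtype.ext (funext fun z => (hν.map_x0Star z).trans (hμ.map_x0Star z).symm)
  · exact Subtype.ext (funext fun z => (hν.map_x1Star z).trans (hμ.map_x1Star z).symm)
  · exact Subtype.ext (funext fun z => (hν.map_negX0Star z).trans (hμ.map_negX0Star z).symm)

/-! ### The image -/

section Image

theorem ratAlgebra_smul_apply (r : ratAlgebra) (f : cleftPlane → ℂ) : r • f = r.1 * f := rfl

theorem polyLi_mem_polylogModule {S : Series} (hS : S ∈ polynomialSubalgebra) :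
    (fun z : cleftPlane => polyLi S z) ∈ polylogModule := by
  refine polynomial_induction (p := fun S => (fun z : cleftPlane => polyLi S z) ∈ polylogModule)
    ?_ ?_ ?_ hS
  · simp only [polyLi_zero]
    exact zero_mem _
  · intro S hS T hT h1 h2
    simp only [polyLi_add hS hT]
    exact add_mem h1 h2
  · intro c w
    simp only [polyLi_smul, polyLi_word]
    exact polylogModule.smul_mem (algebraMap ℂ ratAlgebra c) (Submodule.subset_span ⟨w, rfl⟩)

theorem ratMonomial_mem_ratAlgebra (p : ℤ × ℕ) :
    (fun z : cleftPlane => (z : ℂ) ^ p.1 * ((1 - (z : ℂ))⁻¹) ^ p.2) ∈ ratAlgebra := by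
  obtain ⟨k, l⟩ := p
  refine ratAlgebra.mul_mem (x := fun z : cleftPlane => (z : ℂ) ^ k)
    (y := fun z : cleftPlane => ((1 - (z : ℂ))⁻¹) ^ l) ?_ ?_
  · obtain ⟨n, rfl | rfl⟩ := k.eq_nat_or_neg
    · simp only [zpow_natCast]
      exact ratAlgebra.pow_mem (x := fun z : cleftPlane => (z : ℂ))
        (Algebra.subset_adjoin (by simp)) n
    · simp only [zpow_neg, zpow_natCast, ← inv_pow]
      exact ratAlgebra.pow_mem (x := fun z : cleftPlane => (z : ℂ)⁻¹)
        (Algebra.subset_adjoin (by simp)) n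
  · exact ratAlgebra.pow_mem
      (x := fun z : cleftPlane => (1 - (z : ℂ))⁻¹) (Algebra.subset_adjoin (by simp)) l

theorem toHolo_mem_polylogModule (x : StarCombination) : (toHolo x).1 ∈ polylogModule := by
  induction x using AddMonoidAlgebra.induction_linear with
  | zero => rw [map_zero]; exact zero_mem _
  | add x y hx hy => rw [map_add]; exact add_mem hx hy
  | single p S =>
    have h : (toHolo (AddMonoidAlgebra.single p S)).1 =
        (⟨_, ratMonomial_mem_ratAlgebra p⟩ : ratAlgebra) • fun z : cleftPlane => polyLi S.1 z := by
      ext z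
      rw [toHolo_single, mul_comm]
      rfl
    rw [h]
    exact polylogModule.smul_mem _ (polyLi_mem_polylogModule S.2)

theorem range_liOne :
    (Set.range fun S => (liOne S : cleftPlane → ℂ)) =
      (polylogModule : Set (cleftPlane → ℂ)) := by
  refine Subset.antisymm ?_ ?_
  · rintro _ ⟨S, rfl⟩
    obtain ⟨x, hx⟩ := exists_toSeries_eq S.2
    change (liOne S).1 ∈ polylogModule
    rw [liOne_eq hx]
    exact toHolo_mem_polylogModule x
  -- The image is a ring containing `𝒞`, so it is stable under the action of `𝒞`; it also contains
  -- every `Li_w`.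
  · let B : Subalgebra ℂ (cleftPlane → ℂ) := (holo.val.comp liOne).range
    have hB : ratAlgebra ≤ B := by
      refine Algebra.adjoin_le ?_
      rintro f (rfl | rfl | rfl)
      · exact ⟨x0Star, funext isLiOne_liOne.map_x0Star⟩
      · exact ⟨negX0Star, funext fun z => (isLiOne_liOne.map_negX0Star z).trans (one_div _)⟩
      · exact ⟨x1Star, funext fun z => (isLiOne_liOne.map_x1Star z).trans (one_div _)⟩
    intro f hf
    change f ∈ B
    refine Submodule.span_induction (p := fun f _ => f ∈ B) ?_ (zero_mem B)
      (fun _ _ _ _ => add_mem) (fun r f _ hf => ?_) hf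
    · rintro _ ⟨w, rfl⟩
      exact ⟨wordElt w, funext (isLiOne_liOne.map_word w)⟩
    · rw [ratAlgebra_smul_apply]
      exact mul_mem (hB r.2) hf

end Image

/-! ### The kernel -/

section Kernel

open Polynomial

/-- The ideal generated by `x₀^* ⧢ x₁^* - x₁^* + 1`. -/
noncomputable def starIdeal : Ideal starAlgebra := Ideal.span {x0Star * x1Star - x1Star + 1}

theorem starIdeal_le_ker : starIdeal ≤ RingHom.ker liOne := by
  rw [starIdeal, Ideal.span_singleton_le_iff_mem, RingHom.mem_ker, map_add, map_sub, map_mul,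
    map_one]
  ext z
  change (liOne x0Star).1 z * (liOne x1Star).1 z - (liOne x1Star).1 z + 1 = 0
  rw [isLiOne_liOne.map_x0Star, isLiOne_liOne.map_x1Star]
  have := one_sub_ne_zero_of_mem_cleftPlane z.2
  field_simp
  ring

theorem x0Star_mul_negX0Star : x0Star * negX0Star = 1 := by
  ext1
  change (x0Star : Series) * negX0Star = 1
  rw [x0Star_coe, negX0Star_coe, starSeries_mul, ← starExponent_add, ← starSeries_zero]
  congr 1
  ext i
  fin_cases i <;> simp [starExponent]

/-- Polynomials in `x₀^*` over the noncommutative polynomials. -/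
noncomputable def evalX0Star : polynomialSubalgebra[X] →+* starAlgebra :=
  eval₂RingHom (Subalgebra.inclusion fun _ => polynomials_subset_starAlgebra).toRingHom x0Star

theorem evalX0Star_X : evalX0Star X = x0Star := eval₂_X _ _

theorem evalX0Star_C (S : polynomialSubalgebra) :
    evalX0Star (C S) = ⟨S.1, polynomials_subset_starAlgebra S.2⟩ := eval₂_C _ _

/-- Clearing denominators: modulo the ideal, `(1 - x₀^*) ⧢ x₁^* = 1`, while `x₀^* ⧢ (-x₀)^* = 1`
holds exactly. The property holds on generators and passes to sums and products. -/
theorem exists_pow_mul_sub_evalX0Star_mem (S : Series) (hS : S ∈ starAlgebra) :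
    ∃ (n : ℕ) (q : polynomialSubalgebra[X]),
      (x0Star * (1 - x0Star)) ^ n * ⟨S, hS⟩ - evalX0Star q ∈ starIdeal := by
  have hgen : x0Star * x1Star - x1Star + 1 ∈ starIdeal := Ideal.mem_span_singleton_self _
  induction hS using Algebra.adjoin_induction with
  | mem S hS =>
    rcases hS with hS | rfl | rfl | rfl
    · refine ⟨0, C ⟨S, hS⟩, ?_⟩
      rw [evalX0Star_C, pow_zero, one_mul, sub_self]
      exact zero_mem _
    · refine ⟨0, X, ?_⟩
      rw [evalX0Star_X, pow_zero, one_mul]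
      change x0Star - x0Star ∈ starIdeal
      rw [sub_self]
      exact zero_mem _
    · refine ⟨1, X, ?_⟩
      rw [evalX0Star_X, pow_one]
      change x0Star * (1 - x0Star) * x1Star - x0Star ∈ starIdeal
      convert starIdeal.mul_mem_left (-x0Star) hgen using 1
      ring
    · refine ⟨1, 1 - X, ?_⟩
      rw [map_sub, map_one, evalX0Star_X, pow_one]
      change x0Star * (1 - x0Star) * negX0Star - (1 - x0Star) ∈ starIdeal
      convert zero_mem starIdeal using 1
      linear_combination (1 - x0Star) * x0Star_mul_negX0Star
  | algebraMap c =>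
    refine ⟨0, C (algebraMap ℂ _ c), ?_⟩
    rw [evalX0Star_C, pow_zero, one_mul]
    convert zero_mem starIdeal using 1
    exact sub_self _
  | add S T hS hT h1 h2 =>
    obtain ⟨m, q, hq⟩ := h1
    obtain ⟨n, r, hr⟩ := h2
    refine ⟨m + n, (X * (1 - X)) ^ n * q + (X * (1 - X)) ^ m * r, ?_⟩
    convert add_mem (starIdeal.mul_mem_left ((x0Star * (1 - x0Star)) ^ n) hq)
      (starIdeal.mul_mem_left ((x0Star * (1 - x0Star)) ^ m) hr) using 1
    have h3 : (⟨S + T, add_mem hS hT⟩ : starAlgebra) = ⟨S, hS⟩ + ⟨T, hT⟩ := rfl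
    rw [h3]
    simp only [map_add, map_mul, map_pow, map_sub, map_one, evalX0Star_X]
    ring
  | mul S T hS hT h1 h2 =>
    obtain ⟨m, q, hq⟩ := h1
    obtain ⟨n, r, hr⟩ := h2
    refine ⟨m + n, q * r, ?_⟩
    convert add_mem (starIdeal.mul_mem_left ((x0Star * (1 - x0Star)) ^ n * ⟨T, hT⟩) hq)
      (starIdeal.mul_mem_left (evalX0Star q) hr) using 1
    have h3 : (⟨S * T, mul_mem hS hT⟩ : starAlgebra) = ⟨S, hS⟩ * ⟨T, hT⟩ := rfl
    rw [h3, map_mul]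
    ring

/-- At a fixed `z` the star `x₀^*` becomes the scalar `z`, which can be absorbed into the
noncommutative polynomial. -/
theorem liOne_evalX0Star (q : polynomialSubalgebra[X]) (z : cleftPlane) :
    (liOne (evalX0Star q)).1 z =
      polyLi (∑ k ∈ Finset.range (q.natDegree + 1), (z : ℂ) ^ k • (q.coeff k).1) z := by
  have h1 : polyLi (∑ k ∈ Finset.range (q.natDegree + 1), (z : ℂ) ^ k • (q.coeff k).1) z =
      (polyLiHom (∑ k ∈ Finset.range (q.natDegree + 1), (z : ℂ) ^ k • q.coeff k)).1 z := by
    change _ = polyLi (polynomialSubalgebra.val _) z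
    rw [map_sum]
    rfl
  let evalHom : holo →+* ℂ := (Pi.evalRingHom (fun _ : cleftPlane => ℂ) z).comp holo.val.toRingHom
  change evalHom (liOne (evalX0Star q)) = _
  rw [h1]
  change _ = evalHom
    (polyLiHom (∑ k ∈ Finset.range (q.natDegree + 1), (z : ℂ) ^ k • q.coeff k))
  have h2 : evalX0Star q = ∑ k ∈ Finset.range (q.natDegree + 1),
      (⟨(q.coeff k).1, polynomials_subset_starAlgebra (q.coeff k).2⟩ : starAlgebra) *
        x0Star ^ k := eval₂_eq_sum_range _ _
  rw [h2]
  simp only [map_sum, map_mul, map_pow]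
  refine Finset.sum_congr rfl fun k _ => ?_
  have h3 : evalHom (liOne x0Star) = z := isLiOne_liOne.map_x0Star z
  have h4 : evalHom (liOne ⟨(q.coeff k).1, polynomials_subset_starAlgebra (q.coeff k).2⟩) =
    polyLi (q.coeff k).1 z := liOne_polynomial (q.coeff k) z
  rw [h3, h4, map_smul, mul_comm]
  rfl

/-- Regrouping by words instead of by powers of `x₀^*`, the image is a combination of the `Li_w`
with coefficients `P w` in `ℂ[z]`, so linear independence applies. -/
theorem eq_zero_of_liOne_evalX0Star_eq_zero {q : polynomialSubalgebra[X]}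
    (h : liOne (evalX0Star q) = 0) : q = 0 := by
  let P : List (Fin 2) → ℂ[X] := fun w =>
    ∑ k ∈ Finset.range (q.natDegree + 1), C ((q.coeff k).1 w) * X ^ k
  choose N hN using fun k => mem_polynomials_iff.1 (q.coeff k).2
  have hP (w : List (Fin 2)) (hw : ∑ k ∈ Finset.range (q.natDegree + 1), N k ≤ w.length) :
      P w = 0 := by
    refine Finset.sum_eq_zero fun k hk => ?_
    rw [hN k w ((Finset.single_le_sum (fun _ _ => Nat.zero_le _) hk).trans hw), C_0, zero_mul]
  have hspec (z : ℂ) : specialize P z =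
      ∑ k ∈ Finset.range (q.natDegree + 1), z ^ k • (q.coeff k).1 := by
    ext w
    rw [sum_coeff, specialize, eval_finsetSum]
    refine Finset.sum_congr rfl fun k _ => ?_
    rw [smul_coeff, eval_mul, eval_C, eval_pow, eval_X, mul_comm]
  have hP0 : P = 0 := eq_zero_of_polyLi_specialize_eq_zero hP fun z hz => by
    rw [hspec]
    refine (liOne_evalX0Star q ⟨z, hz⟩).symm.trans ?_
    rw [h]
    rfl
  ext1 k
  rw [coeff_zero]
  by_cases hk : k ∈ Finset.range (q.natDegree + 1)
  · refine Subtype.ext (NCSeries.ext fun w => ?_)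
    have h1 := congrArg (fun p => p.coeff k) (congrFun hP0 w)
    simp only [P, finsetSum_coeff, coeff_C_mul_X_pow, Pi.zero_apply, coeff_zero] at h1
    rw [Finset.sum_ite_eq, if_pos hk] at h1
    exact h1
  · exact coeff_eq_zero_of_natDegree_lt (by simpa [Nat.lt_succ_iff] using hk)

theorem ker_liOne : RingHom.ker liOne = starIdeal := by
  refine le_antisymm (fun S hS => ?_) starIdeal_le_ker
  obtain ⟨n, q, hq⟩ := exists_pow_mul_sub_evalX0Star_mem S.1 S.2
  have hq0 : q = 0 := by
    refine eq_zero_of_liOne_evalX0Star_eq_zero ?_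
    have h1 : liOne _ = 0 := starIdeal_le_ker hq
    rw [map_sub, map_mul] at h1
    have h2 : liOne ⟨S.1, S.2⟩ = 0 := hS
    rw [h2, mul_zero, zero_sub, neg_eq_zero] at h1
    exact h1
  rw [hq0, map_zero, sub_zero] at hq
  -- The denominator cleared before is a unit modulo the ideal, with inverse `(-x₀)^* ⧢ x₁^*`, so it
  -- can be cancelled.
  have hunit : IsUnit (Ideal.Quotient.mk starIdeal (x0Star * (1 - x0Star))) := by
    refine IsUnit.of_mul_eq_one (Ideal.Quotient.mk starIdeal (negX0Star * x1Star)) ?_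
    rw [← map_mul, ← map_one (Ideal.Quotient.mk starIdeal), Ideal.Quotient.eq]
    have hgen : x0Star * x1Star - x1Star + 1 ∈ starIdeal := Ideal.mem_span_singleton_self _
    convert starIdeal.mul_mem_left (-1) hgen using 1
    linear_combination (1 - x0Star) * x1Star * x0Star_mul_negX0Star
  rw [← Ideal.Quotient.eq_zero_iff_mem, map_mul, map_pow] at hq
  exact Ideal.Quotient.eq_zero_iff_mem.1 (((hunit.pow n).mul_right_eq_zero).1 hq)

end Kernel

end PolylogShuffle

theorem mainTheorem1 :
    ∃ μ : PolylogShuffle.starAlgebra →ₐ[ℂ] PolylogShuffle.holo,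
      PolylogShuffle.IsLiOne μ ∧
      (∀ ν : PolylogShuffle.starAlgebra →ₐ[ℂ] PolylogShuffle.holo,
        PolylogShuffle.IsLiOne ν → ν = μ) ∧
      (Set.range fun S => (μ S : PolylogShuffle.cleftPlane → ℂ)) =
        (PolylogShuffle.polylogModule : Set (PolylogShuffle.cleftPlane → ℂ)) ∧
      RingHom.ker μ =
        Ideal.span {PolylogShuffle.x0Star * PolylogShuffle.x1Star - PolylogShuffle.x1Star + 1} :=
  ⟨PolylogShuffle.liOne, PolylogShuffle.isLiOne_liOne,
    fun _ hν => hν.eq PolylogShuffle.isLiOne_liOne, PolylogShuffle.range_liOne,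
    PolylogShuffle.ker_liOne⟩
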